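/- Let $\omega=(1+\sqrt{-3})/2$ and $K=\mathbb{Q}(\sqrt{-3})\subset\mathbb{C}$, let $\mathcal{X}=\{z\in\mathbb{C} : |z|=1\}$ with the Euclidean distance, and let $\mathcal{Z}=\mathcal{X}\cap K$. Every $y\in K$ can be written uniquely as $y=(a+b\omega)/c$ with $a,b,c\in\mathbb{Z}$ having no common factor and $c>0$; put $\mathrm{Ht}(y)=c$. For $P\in\mathcal{X}\setminus\mathcal{Z}$ let $$\delta(P)=\liminf_{y\in\mathcal{Z},\ \mathrm{Ht}(y)\to\infty}\mathrm{Ht}(y)\,|P-y| ,$$ and let $\mathscr{L}=\{1/\delta(P) : P\in\mathcal{X}\setminus\mathcal{Z},\ \delta(P)>0\}$ be the Lagrange spectrum. Then, for each $k\ge 1$, the set $\{\delta(P) : P\in\mathcal{X}\setminus\mathcal{Z}\}$ has a $k$-th largest element $\delta_k>0$, and $1/\delta_k$ is the $k$-th smallest element of $\mathscr{L}$. Put $\lambda=(3+\sqrt{13})/2$ and $\overline{\lambda}=(3-\sqrt{13})/2$. Then (a) $\delta_1=\frac12$, so that the minimum of $\mathscr{L}$ (the Hurwitz bound) is $2$;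 (b) $\delta_2=\sqrt{3/13}$; (c) for every $k\ge 3$, $$\delta_k=\frac{\sqrt3}{2}\Bigg/\sqrt{4-\frac{13}{\left(\lambda^{2k-3}-\overline{\lambda}^{\,2k-3}\right)^2}} .$$ In particular, $\delta_k\to\frac{\sqrt3}{4}$ as $k\to\infty$, and $\frac{4}{\sqrt3}$ is the smallest accumulation point of $\mathscr{L}$. -/

import Mathlib

open Filter Topology
open scoped ENNReal

noncomputable section

/-- The approximation constant of a point `P` of a metric space, with respect to a set `Z` of
"rational points", a height function `Ht` on `Z` and a Dirichlet function `ψ`: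
the limit inferior of `dist P y / ψ (Ht y)` over `y ∈ Z` as `Ht y → ∞`.
It is taken in `[0, ∞]`, where every limit inferior exists. -/
def approxConst {X : Type*} [MetricSpace X] (Z : Set X) (Ht : X → ℝ) (ψ : ℝ → ℝ) (P : X) : ℝ≥0∞ :=
  liminf (fun y : X => ENNReal.ofReal (dist P y / ψ (Ht y))) (comap Ht atTop ⊓ 𝓟 Z)

/-- `ω = (1 + √-3) / 2`. -/
def eisOmega : ℂ := (1 + (√3 : ℝ) * Complex.I) / 2

/-- The field `K = ℚ(√-3)`, as a subfield of `ℂ`. -/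
def eisField : IntermediateField ℚ ℂ :=
  IntermediateField.adjoin ℚ {((√3 : ℝ) : ℂ) * Complex.I}

/-- The unit circle `|z| = 1` in `ℂ`. -/
def unitCircleC : Set ℂ := {z : ℂ | ‖z‖ = 1}

/-- The points of the unit circle which lie in `K`. -/
def eisPoints : Set ℂ := unitCircleC ∩ (eisField : Set ℂ)

/-- The height (denominator) of `y ∈ K`: the unique positive integer `c` such that
`y = (a + b ω) / c` with integers `a`, `b` and `a`, `b`, `c` having no common factor.
(The set below has exactly one element for `y ∈ K`, see `eisHeight_eq` and `exists_eisRep`;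
outside `K` it is empty and the value is irrelevant.) -/
def eisHeight (y : ℂ) : ℕ :=
  sInf {c : ℕ | 0 < c ∧ ∃ a b : ℤ, Int.gcd (Int.gcd a b) c = 1 ∧
    y = ((a : ℂ) + (b : ℂ) * eisOmega) / (c : ℂ)}

theorem eisOmega_sq : eisOmega ^ 2 = eisOmega - 1 := by
  have h : ((√3 : ℝ) : ℂ) ^ 2 = 3 := by
    rw [← Complex.ofReal_pow, Real.sq_sqrt (by norm_num)]; norm_num
  unfold eisOmega
  linear_combination (Complex.I ^ 2 / 4) * h + (3 / 4) * Complex.I_sq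

theorem eisOmega_indep {a b : ℚ} (h : (a : ℂ) + b * eisOmega = 0) : a = 0 ∧ b = 0 := by
  have him := congrArg Complex.im h
  have hre := congrArg Complex.re h
  simp [eisOmega] at him hre
  subst him
  simpa using hre

/-- The height is well defined. -/
theorem eisHeight_eq {a b : ℤ} {c : ℕ} (hc : 0 < c) (hg : Int.gcd (Int.gcd a b) c = 1) :
    eisHeight (((a : ℂ) + (b : ℂ) * eisOmega) / (c : ℂ)) = c := by
  have key : {c' : ℕ | 0 < c' ∧ ∃ a' b' : ℤ, Int.gcd (Int.gcd a' b') c' = 1 ∧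
      ((a : ℂ) + (b : ℂ) * eisOmega) / (c : ℂ) =
        ((a' : ℂ) + (b' : ℂ) * eisOmega) / (c' : ℂ)} = {c} := by
    ext c'
    simp only [Set.mem_ofPred_eq, Set.mem_singleton_iff]
    constructor
    · rintro ⟨hc', a', b', hg', h⟩
      have h1 : (c : ℂ) ≠ 0 := by exact_mod_cast hc.ne'
      have h2 : (c' : ℂ) ≠ 0 := by exact_mod_cast hc'.ne'
      rw [div_eq_div_iff h1 h2] at h
      have h3 : (((a * c' - a' * c : ℤ) : ℚ) : ℂ) + ((b * c' - b' * c : ℤ) : ℚ) * eisOmega = 0 := by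
        push_cast
        linear_combination h
      obtain ⟨ha, hb⟩ := eisOmega_indep h3
      have ha' : a * c' = a' * c := by exact_mod_cast sub_eq_zero.mp (by exact_mod_cast ha)
      have hb' : b * c' = b' * c := by exact_mod_cast sub_eq_zero.mp (by exact_mod_cast hb)
      have dvd : ∀ (a b a' b' : ℤ) (c c' : ℕ), Int.gcd (Int.gcd a b) c = 1 →
          a * c' = a' * c → b * c' = b' * c → c ∣ c' := by
        intro a b a' b' c c' hg ha hb
        have e1 : (c : ℤ) ∣ c' * a := ⟨a', by linarith⟩
        have e2 : (c : ℤ) ∣ c' * b := ⟨b', by linarith⟩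
        have e3 : (c : ℤ) ∣ c' * Int.gcd a b := by
          rw [Int.gcd_eq_gcd_ab, mul_add, ← mul_assoc, ← mul_assoc]
          exact dvd_add (e1.mul_right _) (e2.mul_right _)
        have e4 : IsCoprime (c : ℤ) (Int.gcd a b) := (Int.isCoprime_iff_gcd_eq_one.mpr hg).symm
        exact_mod_cast e4.dvd_of_dvd_mul_right e3
      exact Nat.dvd_antisymm (dvd a' b' a b c' c hg' ha'.symm hb'.symm)
        (dvd a b a' b' c c' hg ha' hb')
    · rintro rfl
      exact ⟨hc, a, b, hg, rfl⟩
  unfold eisHeight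
  rw [key]
  exact csInf_singleton c

/-- Every element of `K` has a reduced representation `(a + b ω) / c`. -/
theorem exists_eisRep {y : ℂ} (hy : y ∈ eisField) :
    ∃ (a b : ℤ) (c : ℕ), 0 < c ∧ Int.gcd (Int.gcd a b) c = 1 ∧
      y = ((a : ℂ) + (b : ℂ) * eisOmega) / (c : ℂ) := by
  have h3 : ((√3 : ℝ) : ℂ) ^ 2 = 3 := by
    rw [← Complex.ofReal_pow, Real.sq_sqrt (by norm_num)]; norm_num
  have hrat : ∃ p q : ℚ, y = p + q * eisOmega := by
    unfold eisField at hy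
    induction hy using IntermediateField.adjoin_induction with
    | mem x hx =>
      rw [Set.mem_singleton_iff] at hx
      refine ⟨-1, 2, ?_⟩
      rw [hx]; unfold eisOmega; push_cast; ring
    | algebraMap x => exact ⟨x, 0, by simp⟩
    | add x y _ _ hx hy =>
      obtain ⟨p, q, rfl⟩ := hx
      obtain ⟨r, s, rfl⟩ := hy
      exact ⟨p + r, q + s, by push_cast; ring⟩
    | mul x y _ _ hx hy =>
      obtain ⟨p, q, rfl⟩ := hx
      obtain ⟨r, s, rfl⟩ := hy
      refine ⟨p * r - q * s, p * s + q * r + q * s, ?_⟩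
      push_cast
      linear_combination (q * s : ℂ) * eisOmega_sq
    | inv x _ hx =>
      obtain ⟨p, q, rfl⟩ := hx
      by_cases h0 : (p : ℂ) + q * eisOmega = 0
      · exact ⟨0, 0, by simp [h0]⟩
      have hN : p ^ 2 + p * q + q ^ 2 ≠ 0 := by
        intro h
        have hq : q = 0 := by nlinarith [sq_nonneg (2 * p + q), sq_nonneg q]
        have hp : p = 0 := by subst hq; simpa using h
        exact h0 (by simp [hp, hq])
      have hN' : (p : ℂ) ^ 2 + p * q + q ^ 2 ≠ 0 := by exact_mod_cast hN
      refine ⟨(p + q) / (p ^ 2 + p * q + q ^ 2), -q / (p ^ 2 + p * q + q ^ 2), ?_⟩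
      push_cast
      have e : ((p : ℂ) + q) / (p ^ 2 + p * q + q ^ 2) +
          -q / (p ^ 2 + p * q + q ^ 2) * eisOmega =
          ((p + q) - q * eisOmega) / (p ^ 2 + p * q + q ^ 2) := by ring
      rw [e]
      apply inv_eq_of_mul_eq_one_right
      rw [← mul_div_assoc, div_eq_one_iff_eq hN']
      linear_combination -(q : ℂ) ^ 2 * eisOmega_sq
  obtain ⟨p, q, rfl⟩ := hrat
  set c₀ : ℕ := p.den * q.den with hc₀
  set A : ℤ := p.num * q.den with hA
  set B : ℤ := q.num * p.den with hB
  have hc₀pos : 0 < c₀ := Nat.mul_pos p.den_pos q.den_pos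
  set g : ℕ := Int.gcd (Int.gcd A B) c₀ with hg
  have hgpos : 0 < g := Int.gcd_pos_of_ne_zero_right _ (by exact_mod_cast hc₀pos.ne')
  have hg1 : (g : ℤ) ∣ (Int.gcd A B : ℤ) := Int.gcd_dvd_left _ _
  obtain ⟨a, ha⟩ : (g : ℤ) ∣ A := hg1.trans (Int.gcd_dvd_left _ _)
  obtain ⟨b, hb⟩ : (g : ℤ) ∣ B := hg1.trans (Int.gcd_dvd_right _ _)
  obtain ⟨c, hc⟩ : g ∣ c₀ := by exact_mod_cast (Int.gcd_dvd_right (Int.gcd A B : ℤ) (c₀ : ℤ))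
  have hcpos : 0 < c := Nat.pos_of_ne_zero (by rintro rfl; simp at hc; omega)
  refine ⟨a, b, c, hcpos, ?_, ?_⟩
  · have h5 : g * Int.gcd (Int.gcd a b) c = g * 1 := by
      have : Int.gcd ((Int.gcd A B : ℕ) : ℤ) c₀ = g * Int.gcd (Int.gcd a b) c := by
        rw [ha, hb, hc, Int.gcd_mul_left]
        push_cast
        simp [Int.gcd_mul_left]
      rw [← this, mul_one]
    exact Nat.eq_of_mul_eq_mul_left hgpos h5
  · have hgC : (g : ℂ) ≠ 0 := by exact_mod_cast hgpos.ne'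
    have hcC : (c : ℂ) ≠ 0 := by exact_mod_cast hcpos.ne'
    have hpd : (p.den : ℂ) ≠ 0 := by exact_mod_cast p.den_pos.ne'
    have hqd : (q.den : ℂ) ≠ 0 := by exact_mod_cast q.den_pos.ne'
    have e1 : (p.num : ℂ) * q.den = g * a := by exact_mod_cast ha
    have e2 : (q.num : ℂ) * p.den = g * b := by exact_mod_cast hb
    have e3 : (p.den : ℂ) * q.den = g * c := by exact_mod_cast hc
    have e4 : (p : ℂ) = a / c := by
      rw [Rat.cast_def, div_eq_div_iff hpd hcC]
      apply mul_left_cancel₀ (mul_ne_zero hgC hqd)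
      linear_combination (g * c : ℂ) * e1 - (g * a : ℂ) * e3
    have e5 : (q : ℂ) = b / c := by
      rw [Rat.cast_def, div_eq_div_iff hqd hcC]
      apply mul_left_cancel₀ (mul_ne_zero hgC hpd)
      linear_combination (g * c : ℂ) * e2 - (g * b : ℂ) * e3
    rw [e4, e5]; ring

/-- The approximation constant `δ(z)` on the unit circle, for the points in `K`, the height given
by the denominator, the Euclidean distance, and `ψ(H) = H⁻¹`. -/
def eisDelta (z : ℂ) : ℝ≥0∞ :=
  approxConst eisPoints (fun y => (eisHeight y : ℝ)) (fun H => H⁻¹) z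

/-- The set of all approximation constants `δ(P)`, for `P` on the unit circle and not in `K`. -/
def eisDeltaSet : Set ℝ≥0∞ := eisDelta '' (unitCircleC \ eisPoints)

/-- The Lagrange spectrum: all Lagrange numbers `1 / δ(P)`, for `P` on the unit circle and not in
`K` such that `δ(P) > 0`. -/
def eisLagrangeSpectrum : Set ℝ :=
  {L : ℝ | ∃ P ∈ unitCircleC \ eisPoints, 0 < eisDelta P ∧ L = (eisDelta P)⁻¹.toReal}

/-- `x` is the `k`-th largest element of `S` (`k ≥ 1`): it belongs to `S`, and exactly `k - 1`
elements of `S` are larger. -/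
def IsKthLargest {α : Type*} [LinearOrder α] (S : Set α) (k : ℕ) (x : α) : Prop :=
  x ∈ S ∧ {y ∈ S | x < y}.encard + 1 = k

/-- `x` is the `k`-th smallest element of `S` (`k ≥ 1`): it belongs to `S`, and exactly `k - 1`
elements of `S` are smaller. -/
def IsKthSmallest {α : Type*} [LinearOrder α] (S : Set α) (k : ℕ) (x : α) : Prop :=
  x ∈ S ∧ {y ∈ S | y < x}.encard + 1 = k

end

/-! The map `circlePt` parametrizes the circle without 1 by real x, and the points of K on it
correspond to the fractions p/q. With N = `eisNorm`, the height of p/q is q² N(p/q), divided by 3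
when 3 ∣ p, and the chord from x to y has length √3 |x - y| / √(N(x) N(y)). Since N(p/q) tends to
N(x) along good approximations, δ is the limit inferior of `cuspDist`, which is √3 q|qx - p| or q|qx
- p|/√3 according as 3 ∤ p or 3 ∣ p (`dist_mul_eisHeight`).

This is approximation by the two kinds of cusps of a congruence group of level three. Its geometry
is a tessellation of the upper half plane by ideal hexagons, the images of the one with vertices ∞,
0, 1, 3/2, 2, 3; every side joins a fraction with numerator divisible by three to one without that
property. The geodesic from ∞ to x crosses a chain of sides. In the coordinate of the n-th side it
runs from -η n to ξ n, and its widths ξ + η and 3/ξ + 3/η, seen from the two cusps of that side, are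
√3 divided by the `cuspDist` of these cusps (`CrossesSide.exists_cuspDist`). Conversely a fraction
with `cuspDist` below 1/√3 is an endpoint of a crossed side, and every crossed side occurs in the
chain (`exists_crossesSide_of_not_dvd`, `exists_crossesSide_of_dvd`,
`IsSideChain.exists_eq_of_crossesSide`). Therefore δ = √3/Λ, where Λ > 3 is the limit superior of
the widths (`IsSideChain.eisDelta_eq`).

It remains to find all Λ below four. If all widths are less than four, only the sides s2, s3, s4
occur, s4 and s2 are never adjacent, and once s4 has occurred each s3 is isolated. The width
conditions at the two ends of an s3 compare the runs of s4 before and after it in the manner of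
continued fractions, and force them to have the same even length (`IsOrbit.run_eq_and_even`). Up to
the reflection x ↦ 3/x, the sides are thus eventually all s3, all s4, or periodic with period s4 (2m
times), s3. Contraction determines the limiting endpoints, and Λ is 2√3, √13 or 2√(4 - 1/B²) with B
= `bronze (2 * m + 1)`. These values increase to 4, and each is attained by a periodic chain, so
they give exactly the constants δ above √3/4. -/

/-- The sides of the ideal hexagon with vertices `∞, 0, 1, 3/2, 2, 3` other than the side `(0, ∞)`,
in increasing order. -/
inductive HexSide
  | s1 | s2 | s3 | s4 | s5

/-! ### The hexagon and its side maps -/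

namespace HexSide

/-- The Möbius map taking `(0, ∞)` onto a side of the hexagon and `∞` to the endpoint of that side
whose numerator is not divisible by three. -/
noncomputable def fwd : HexSide → ℝ → ℝ
  | s1, x => x / (x + 1)
  | s2, x => (x + 3) / (x + 2)
  | s3, x => (2 * x + 3) / (x + 2)
  | s4, x => (2 * x + 3) / (x + 1)
  | s5, x => x + 3

/-- The side through which the hexagon is traversed in the reversed direction. -/
def rev : HexSide → HexSide
  | s2 => s4
  | s4 => s2
  | t => t

/-- The image of a side under `x ↦ 3 / x`. -/
def dual : HexSide → HexSide
  | s1 => s5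
  | s2 => s4
  | s3 => s3
  | s4 => s2
  | s5 => s1

theorem fwd_pos (t : HexSide) {x : ℝ} (hx : 0 < x) : 0 < t.fwd x := by
  cases t <;> simp only [fwd] <;> positivity

/-- The reflection x ↦ 3/x permutes the vertices of the hexagon and preserves the side (0, ∞),
exchanging its two cusps. It halves the case analysis later on. -/
theorem fwd_dual (t : HexSide) {x : ℝ} (hx : 0 < x) : t.dual.fwd (3 / x) = 3 / t.fwd x := by
  cases t <;> simp only [fwd, dual] <;> field_simp <;> ring

theorem rev_dual (t : HexSide) : t.dual.rev = t.rev.dual := by cases t <;> rfl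

theorem fwd_s2_eq {x : ℝ} (hx : 0 < x) : s2.fwd x = 1 + 1 / (x + 2) := by
  simp only [fwd]; field_simp; ring

theorem fwd_s4_eq {x : ℝ} (hx : 0 < x) : s4.fwd x = 2 + 1 / (x + 1) := by
  simp only [fwd]; field_simp; ring

theorem fwd_s1_lt {x : ℝ} (hx : 0 < x) : s1.fwd x < 1 := by
  simp only [fwd]; rw [div_lt_one (by linarith)]; linarith

theorem lt_fwd_s2 {x : ℝ} (hx : 0 < x) : 1 < s2.fwd x := by
  simp only [fwd]; rw [lt_div_iff₀ (by linarith)]; linarith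

theorem fwd_s2_lt {x : ℝ} (hx : 0 < x) : s2.fwd x < 3 / 2 := by
  simp only [fwd]; rw [div_lt_iff₀ (by linarith)]; linarith

theorem lt_fwd_s3 {x : ℝ} (hx : 0 < x) : 3 / 2 < s3.fwd x := by
  simp only [fwd]; rw [lt_div_iff₀ (by linarith)]; linarith

theorem fwd_s3_lt {x : ℝ} (hx : 0 < x) : s3.fwd x < 2 := by
  simp only [fwd]; rw [div_lt_iff₀ (by linarith)]; linarith

theorem lt_fwd_s4 {x : ℝ} (hx : 0 < x) : 2 < s4.fwd x := by
  simp only [fwd]; rw [lt_div_iff₀ (by linarith)]; linarith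

theorem fwd_s4_lt {x : ℝ} (hx : 0 < x) : s4.fwd x < 3 := by
  simp only [fwd]; rw [div_lt_iff₀ (by linarith)]; linarith

theorem lt_fwd_s5 {x : ℝ} (hx : 0 < x) : 3 < s5.fwd x := by
  simp only [fwd]; linarith

/-- The five images of (0, ∞) are disjoint intervals cut out by 1, 3/2, 2, 3, and each side map is
an injective Möbius map. -/
theorem fwd_injective {t t' : HexSide} {x x' : ℝ} (hx : 0 < x) (hx' : 0 < x')
    (h : t.fwd x = t'.fwd x') : t = t' ∧ x = x' := by
  have key : t = t' := by
    have a1 := fwd_s1_lt hx; have b1 := fwd_s1_lt hx'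
    have a2 := lt_fwd_s2 hx; have b2 := lt_fwd_s2 hx'
    have a3 := fwd_s2_lt hx; have b3 := fwd_s2_lt hx'
    have a4 := lt_fwd_s3 hx; have b4 := lt_fwd_s3 hx'
    have a5 := fwd_s3_lt hx; have b5 := fwd_s3_lt hx'
    have a6 := lt_fwd_s4 hx; have b6 := lt_fwd_s4 hx'
    have a7 := fwd_s4_lt hx; have b7 := fwd_s4_lt hx'
    have a8 := lt_fwd_s5 hx; have b8 := lt_fwd_s5 hx'
    cases t <;> cases t' <;> first | rfl | (exfalso; linarith)
  subst key
  refine ⟨rfl, ?_⟩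
  have e1 : x + 1 ≠ 0 := by linarith
  have e2 : x' + 1 ≠ 0 := by linarith
  have e3 : x + 2 ≠ 0 := by linarith
  have e4 : x' + 2 ≠ 0 := by linarith
  cases t <;> simp only [fwd] at h
  · rw [div_eq_div_iff e1 e2] at h; linarith
  · rw [div_eq_div_iff e3 e4] at h; linarith
  · rw [div_eq_div_iff e3 e4] at h; linarith
  · rw [div_eq_div_iff e1 e2] at h; linarith
  · linarith

end HexSide

/-! ### Orbits all of whose widths are less than four -/

open HexSide

/-- The coordinates `ξ n`, `η n` of the endpoints of a geodesic, as seen from the successive sides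
of the hexagonal tessellation which it crosses; `d` records the sides. -/
structure IsOrbit (d : ℕ → HexSide) (ξ η : ℕ → ℝ) : Prop where
  fwd_pos : ∀ n, 0 < ξ n
  bwd_pos : ∀ n, 0 < η n
  fwd_eq : ∀ n, ξ n = (d n).fwd (ξ (n + 1))
  bwd_eq : ∀ n, η (n + 1) = (d n).rev.fwd (η n)

/-- The larger of the two widths of a geodesic seen from the two cusps of a side it crosses. -/
noncomputable def sideWidth (x y : ℝ) : ℝ := max (x + y) (3 / x + 3 / y)

theorem sideWidth_dual {x y : ℝ} : sideWidth (3 / x) (3 / y) = sideWidth x y := by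
  unfold sideWidth
  rw [max_comm, div_div_cancel₀ (by norm_num), div_div_cancel₀ (by norm_num)]

theorem sideWidth_symm {x y : ℝ} : sideWidth x y = sideWidth y x := by
  unfold sideWidth
  rw [add_comm x, add_comm (3 / x)]

theorem bounds_of_sideWidth_lt {x y : ℝ} (hx : 0 < x) (hy : 0 < y) (h : sideWidth x y < 4) :
    1 < x ∧ x < 3 := by
  obtain ⟨h1, h2⟩ := max_lt_iff.mp h
  rw [div_add_div _ _ hx.ne' hy.ne', div_lt_iff₀ (by positivity)] at h2
  -- The second width gives 3x < (4x - 3) y; inserting y < 4 - x from the first leaves (x - 1)(x -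
  -- 3) < 0.
  have h3 : 0 < 4 * x - 3 := by
    by_contra h3
    nlinarith [mul_nonneg hy.le (by linarith : 0 ≤ 3 - 4 * x)]
  have h4 := mul_pos (sub_pos.mpr h1) h3
  constructor <;> nlinarith

namespace IsOrbit

variable {d : ℕ → HexSide} {ξ η : ℕ → ℝ}

theorem tail (h : IsOrbit d ξ η) (N : ℕ) :
    IsOrbit (fun n => d (N + n)) (fun n => ξ (N + n)) (fun n => η (N + n)) :=
  ⟨fun _ => h.fwd_pos _, fun _ => h.bwd_pos _, fun _ => h.fwd_eq _, fun _ => h.bwd_eq _⟩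

theorem dual (h : IsOrbit d ξ η) :
    IsOrbit (fun n => (d n).dual) (fun n => 3 / ξ n) (fun n => 3 / η n) where
  fwd_pos n := div_pos (by norm_num) (h.fwd_pos n)
  bwd_pos n := div_pos (by norm_num) (h.bwd_pos n)
  fwd_eq n := by rw [fwd_dual _ (h.fwd_pos _), ← h.fwd_eq]
  bwd_eq n := by rw [rev_dual, fwd_dual _ (h.bwd_pos _), ← h.bwd_eq]

section

variable (h : IsOrbit d ξ η) (hw : ∀ n, sideWidth (ξ n) (η n) < 4)
include h hw

theorem fwd_bounds (n : ℕ) : 1 < ξ n ∧ ξ n < 3 :=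
  bounds_of_sideWidth_lt (h.fwd_pos n) (h.bwd_pos n) (hw n)

theorem bwd_bounds (n : ℕ) : 1 < η n ∧ η n < 3 :=
  bounds_of_sideWidth_lt (h.bwd_pos n) (h.fwd_pos n) (sideWidth_symm ▸ hw n)

theorem side_cases (n : ℕ) : d n = s2 ∨ d n = s3 ∨ d n = s4 := by
  have hb := h.fwd_bounds hw n
  rw [h.fwd_eq n] at hb
  have h1 := fwd_s1_lt (h.fwd_pos (n + 1))
  have h5 := lt_fwd_s5 (h.fwd_pos (n + 1))
  cases hd : d n <;> simp only [hd] at hb <;> first | (exfalso; linarith) | simp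

/-- Between s4 and s2 both endpoints lie below 3/2, so the width 3/ξ + 3/η exceeds four. -/
theorem side_succ_ne_s2 {n : ℕ} (h4 : d n = s4) : d (n + 1) ≠ s2 := by
  intro h2
  have e1 := h.fwd_eq (n + 1)
  have e2 := h.bwd_eq n
  rw [h2] at e1
  rw [h4] at e2
  have b1 := fwd_s2_lt (h.fwd_pos (n + 1 + 1))
  have b2 : s4.rev.fwd (η n) < 3 / 2 := fwd_s2_lt (h.bwd_pos n)
  rw [← e1] at b1
  rw [← e2] at b2
  have hx := h.fwd_pos (n + 1)
  have hy := h.bwd_pos (n + 1)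
  have h2 := (max_lt_iff.mp (hw (n + 1))).2
  have c1 : 2 < 3 / ξ (n + 1) := by rw [lt_div_iff₀ hx]; linarith
  have c2 : 2 < 3 / η (n + 1) := by rw [lt_div_iff₀ hy]; linarith
  linarith

/-- With X = ξ (n + 2) and Y = η n, the first width between the two sides is (2 + 1/(X + 1)) + (2 -
1/(Y + 2)), so being below four is a comparison of X + 1 with Y + 2. -/
theorem lt_of_s3_s4 {n : ℕ} (h3 : d n = s3) (h4 : d (n + 1) = s4) : 1 + η n < ξ (n + 2) := by
  have h1 := (max_lt_iff.mp (hw (n + 1))).1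
  have hx := h.fwd_pos (n + 2)
  have hy := h.bwd_pos n
  rw [h.fwd_eq (n + 1), h.bwd_eq n, h3, h4] at h1
  simp only [fwd, rev] at h1
  rw [div_add_div _ _ (by positivity) (by positivity), div_lt_iff₀ (by positivity)] at h1
  nlinarith

/-- The mirror image of `lt_of_s3_s4`: the second width is used, 3/x replaces x, and forward and
backward endpoints change roles. -/
theorem lt_of_s4_s3 {n : ℕ} (h4 : d n = s4) (h3 : d (n + 1) = s3) :
    1 + 3 / ξ (n + 2) < 3 / η n := by
  have h1 := (max_lt_iff.mp (hw (n + 1))).2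
  have hx := h.fwd_pos (n + 2)
  have hy := h.bwd_pos n
  rw [h.fwd_eq (n + 1), h.bwd_eq n, h3, h4] at h1
  simp only [fwd, rev, div_div_eq_mul_div] at h1
  rw [div_add_div _ _ (by positivity) (by positivity), div_lt_iff₀ (by positivity)] at h1
  rw [lt_div_iff₀ hy, ← sub_pos]
  have : 3 - (1 + 3 / ξ (n + 2)) * η n = (3 * ξ (n + 2) - ξ (n + 2) * η n - 3 * η n) / ξ (n + 2) := by
    field_simp
    ring
  rw [this]
  exact div_pos (by nlinarith) hx

theorem side_eq_s4_of_two_lt {n : ℕ} (hn : 2 < ξ n) : d n = s4 := by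
  have e := h.fwd_eq n
  have hp := h.fwd_pos (n + 1)
  rcases h.side_cases hw n with h2 | h2 | h2
  · rw [h2] at e; have := fwd_s2_lt hp; linarith
  · rw [h2] at e; have := fwd_s3_lt hp; linarith
  · exact h2

theorem side_eq_s4_of_bwd_lt {n : ℕ} (hn : η (n + 1) < 3 / 2) : d n = s4 := by
  have e := h.bwd_eq n
  have hp := h.bwd_pos n
  rcases h.side_cases hw n with h2 | h2 | h2
  · rw [h2] at e; have : 2 < s2.rev.fwd (η n) := lt_fwd_s4 hp
    linarith
  · rw [h2] at e; have : 3 / 2 < s3.rev.fwd (η n) := lt_fwd_s3 hp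
    linarith
  · exact h2

/-- The inequality of `lt_of_s4_s3` is used twice. As 3/ξ (n + 3) > 1, it gives η (n + 1) < 3/2, so
that side n is s4 and η (n + 1) > 6/5; this bound in turn gives 3/ξ (n + 3) < 3/2, that is ξ (n + 3)
> 2. -/
theorem side_succ_of_s4_s3 {n : ℕ} (h4 : d (n + 1) = s4) (h3 : d (n + 2) = s3) :
    d (n + 3) = s4 := by
  have hlt := h.lt_of_s4_s3 hw h4 h3
  have hb := h.fwd_bounds hw (n + 1 + 2)
  have hη := h.bwd_pos (n + 1)
  have c1 : 1 < 3 / ξ (n + 1 + 2) := by rw [lt_div_iff₀ (by linarith)]; linarith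
  have c2 : η (n + 1) < 3 / 2 := by
    have : 2 < 3 / η (n + 1) := by linarith
    rw [lt_div_iff₀ hη] at this
    linarith
  have h4' := h.side_eq_s4_of_bwd_lt hw c2
  have e := h.bwd_eq n
  have hp := h.bwd_bounds hw n
  have e' : η (n + 1) = 1 + 1 / (η n + 2) := by rw [e, h4']; exact fwd_s2_eq (by linarith)
  have c3 : 1 / 5 < 1 / (η n + 2) := by
    rw [div_lt_div_iff₀ (by norm_num) (by linarith)]; linarith
  have c4 : 3 / η (n + 1) < 5 / 2 := by rw [div_lt_iff₀ hη]; linarith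
  have c5 : 3 / ξ (n + 1 + 2) < 3 / 2 := by linarith
  rw [div_lt_iff₀ (by linarith)] at c5
  exact h.side_eq_s4_of_two_lt hw (n := n + 1 + 2) (by linarith)

end

end IsOrbit

/-! ### Runs of s4 and the classification of side sequences -/

/-- Two sequences descending through `s4` and `s2` from the two sides of a side `s3` compare in
alternating directions, which determines the parity of the shorter of them. -/
theorem parity_of_descent {x y : ℕ → ℝ} {r l : ℕ} (hr : 1 ≤ r) (h0 : 1 + y 0 < x 0)
    (hx : ∀ t, t + 1 < r → x t = s4.fwd (x (t + 1))) (hxp : ∀ t < r, 3 / 2 < x t)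
    (hxe : x (r - 1) < 2)
    (hy : ∀ t < l, y t = s2.fwd (y (t + 1))) (hyp : ∀ t ≤ l, 1 < y t) (hye : 3 / 2 < y l) :
    (l + 1 ≤ r → Odd l) ∧ (r ≤ l + 1 → Even r) := by
  -- Since x t = 2 + 1/(x (t + 1) + 1) and y t = 1 + 1/(y (t + 1) + 2), the comparison of x with 1 +
  -- y is reversed at each step, as for continued fractions.
  have key : ∀ t, t + 1 ≤ r → t ≤ l → (Even t → 1 + y t < x t) ∧ (Odd t → x t < 1 + y t) := by
    intro t
    induction t with
    | zero => intro _ _; exact ⟨fun _ => h0, fun h => by simp at h⟩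
    | succ t ih =>
      intro hr' hl'
      obtain ⟨i1, i2⟩ := ih (by omega) (by omega)
      have ex := hx t (by omega)
      have ey := hy t (by omega)
      have px := hxp (t + 1) (by omega)
      have py := hyp (t + 1) (by omega)
      rw [fwd_s4_eq (by linarith)] at ex
      rw [fwd_s2_eq (by linarith)] at ey
      constructor
      · intro he
        have := i2 (by rw [← Nat.not_even_iff_odd]; exact Nat.even_add_one.mp he)
        have h3 : 1 / (x (t + 1) + 1) < 1 / (y (t + 1) + 2) := by linarith
        rw [div_lt_div_iff₀ (by linarith) (by linarith)] at h3
        linarith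
      · intro ho
        have := i1 (by rw [← Nat.not_odd_iff_even]; exact Nat.odd_add_one.mp ho)
        have h3 : 1 / (y (t + 1) + 2) < 1 / (x (t + 1) + 1) := by linarith
        rw [div_lt_div_iff₀ (by linarith) (by linarith)] at h3
        linarith
  constructor
  -- If y stops first, 1 + y l > 5/2 while x l < 5/2, which fixes the direction at l and hence its
  -- parity.
  · intro hl
    by_contra hodd
    rw [Nat.not_odd_iff_even] at hodd
    have h1 := (key l hl le_rfl).1 hodd
    rcases Nat.lt_or_ge (l + 1) r with h2 | h2
    · have ex := hx l h2
      have px := hxp (l + 1) h2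
      rw [fwd_s4_eq (by linarith)] at ex
      have : 1 / (x (l + 1) + 1) < 1 / 2 := by
        rw [div_lt_div_iff₀ (by linarith) (by norm_num)]; linarith
      linarith
    · have : r - 1 = l := by omega
      rw [this] at hxe
      linarith
  -- If x stops first, x (r - 1) < 2 < 1 + y (r - 1), so r - 1 is odd.
  · intro hl
    by_contra hev
    rw [Nat.not_even_iff_odd] at hev
    have h1 := (key (r - 1) (by omega) (by omega)).1 (by
      obtain ⟨k, hk⟩ := hev; exact ⟨k, by omega⟩)
    have := hyp (r - 1) (by omega)
    linarith

namespace IsOrbit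

variable {d : ℕ → HexSide} {ξ η : ℕ → ℝ}

/-- Two applications of `parity_of_descent` around the middle s3, one at each of its ends. If the
lengths differed, one application would make the shorter one odd and the other would make it even;
if they agree, it is even. -/
theorem run_eq_and_even (h : IsOrbit d ξ η) (hw : ∀ n, sideWidth (ξ n) (η n) < 4) {a l r : ℕ}
    (hl : 1 ≤ l) (hr : 1 ≤ r) (ha : d a = s3) (hal : ∀ i < l, d (a + 1 + i) = s4)
    (hb : d (a + 1 + l) = s3) (hbr : ∀ i < r, d (a + 1 + l + 1 + i) = s4)
    (hc : d (a + 1 + l + 1 + r) = s3) : r = l ∧ Even l := by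
  have fb := h.fwd_bounds hw
  have bb := h.bwd_bounds hw
  -- Here x runs forward through the second run, starting after its first s4, and y runs backward
  -- through the whole first run.
  have h1 := parity_of_descent (x := fun t => ξ (a + 1 + l + 2 + t)) (y := fun t => η (a + 1 + l - t))
    (r := r) (l := l) hr ?_ ?_ ?_ ?_ ?_ ?_ ?_
  -- The mirror image: time is reversed and 3/x replaces x, so the roles of l and r are exchanged.
  have h2 := parity_of_descent (x := fun t => 3 / η (a + l - t)) (y := fun t => 3 / ξ (a + l + 2 + t))
    (r := l) (l := r) hl ?_ ?_ ?_ ?_ ?_ ?_ ?_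
  · obtain ⟨h1, h1'⟩ := h1
    obtain ⟨h2, h2'⟩ := h2
    rcases lt_trichotomy l r with h3 | h3 | h3
    · have := h1 h3
      have := h2' (by omega)
      exact absurd this (Nat.not_even_iff_odd.mpr (h1 h3))
    · exact ⟨h3.symm, h2' (by omega)⟩
    · have := h1' (by omega)
      exact absurd this (Nat.not_even_iff_odd.mpr (h2 h3))
  · have := h.lt_of_s4_s3 hw (n := a + l) ?_ ?_
    · simpa using this
    · have := hal (l - 1) (by omega)
      rwa [show a + 1 + (l - 1) = a + l by omega] at this
    · rwa [show a + l + 1 = a + 1 + l by omega]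
  · intro t ht
    have h4 := hal (l - 2 - t) (by omega)
    have e := h.bwd_eq (a + 1 + (l - 2 - t))
    rw [h4] at e
    show 3 / η (a + l - t) = s4.fwd (3 / η (a + l - (t + 1)))
    rw [show a + l - t = a + 1 + (l - 2 - t) + 1 by omega, e,
      show a + l - (t + 1) = a + 1 + (l - 2 - t) by omega]
    exact (fwd_dual s2 (h.bwd_pos _)).symm
  · intro t ht
    show 3 / 2 < 3 / η (a + l - t)
    rcases Nat.lt_or_ge (t + 1) l with h4 | h4
    · have h4 := hal (l - 2 - t) (by omega)
      have e := h.bwd_eq (a + 1 + (l - 2 - t))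
      rw [h4] at e
      rw [show a + l - t = a + 1 + (l - 2 - t) + 1 by omega, e]
      have := h.bwd_pos (a + 1 + (l - 2 - t))
      have h5 : s4.rev.fwd (η (a + 1 + (l - 2 - t))) < 3 / 2 := fwd_s2_lt this
      rw [div_lt_div_iff_of_pos_left (by norm_num) (by norm_num) (HexSide.fwd_pos _ this)]
      linarith
    · have e := h.bwd_eq a
      rw [ha] at e
      rw [show a + l - t = a + 1 by omega, e]
      have := h.bwd_pos a
      rw [div_lt_div_iff_of_pos_left (by norm_num) (by norm_num) (HexSide.fwd_pos _ this)]
      exact fwd_s3_lt this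
  · have e := h.bwd_eq a
    rw [ha] at e
    show 3 / η (a + l - (l - 1)) < 2
    rw [show a + l - (l - 1) = a + 1 by omega, e, div_lt_iff₀ (HexSide.fwd_pos _ (h.bwd_pos a))]
    have : 3 / 2 < s3.rev.fwd (η a) := lt_fwd_s3 (h.bwd_pos a)
    linarith
  · intro t ht
    have e := h.fwd_eq (a + 1 + l + 1 + t)
    rw [hbr t ht] at e
    show 3 / ξ (a + l + 2 + t) = s2.fwd (3 / ξ (a + l + 2 + (t + 1)))
    rw [show a + l + 2 + t = a + 1 + l + 1 + t by omega, e,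
      show a + l + 2 + (t + 1) = a + 1 + l + 1 + t + 1 by omega]
    exact (fwd_dual s4 (h.fwd_pos _)).symm
  · intro t ht
    show 1 < 3 / ξ (a + l + 2 + t)
    rw [lt_div_iff₀ (h.fwd_pos _)]
    linarith [(fb (a + l + 2 + t)).2]
  · have e := h.fwd_eq (a + 1 + l + 1 + r)
    rw [hc] at e
    show 3 / 2 < 3 / ξ (a + l + 2 + r)
    rw [show a + l + 2 + r = a + 1 + l + 1 + r by omega, e]
    have := h.fwd_pos (a + 1 + l + 1 + r + 1)
    rw [div_lt_div_iff_of_pos_left (by norm_num) (by norm_num) (HexSide.fwd_pos _ this)]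
    exact fwd_s3_lt this
  · have := h.lt_of_s3_s4 hw hb (hbr 0 hr)
    simpa using this
  · intro t ht
    have e := h.fwd_eq (a + 1 + l + 1 + (t + 1))
    rw [hbr _ ht] at e
    show ξ (a + 1 + l + 2 + t) = s4.fwd (ξ (a + 1 + l + 2 + (t + 1)))
    rw [show a + 1 + l + 2 + t = a + 1 + l + 1 + (t + 1) by omega, e,
      show a + 1 + l + 2 + (t + 1) = a + 1 + l + 1 + (t + 1) + 1 by omega]
  · intro t ht
    show 3 / 2 < ξ (a + 1 + l + 2 + t)
    have e := h.fwd_eq (a + 1 + l + 1 + (t + 1))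
    rw [show a + 1 + l + 2 + t = a + 1 + l + 1 + (t + 1) by omega, e]
    have hp := h.fwd_pos (a + 1 + l + 1 + (t + 1) + 1)
    rcases Nat.lt_or_ge (t + 1) r with h4 | h4
    · rw [hbr _ h4]
      linarith [lt_fwd_s4 hp]
    · rw [show t + 1 = r by omega] at hp ⊢
      rw [hc]
      exact lt_fwd_s3 hp
  · have e := h.fwd_eq (a + 1 + l + 1 + r)
    rw [hc] at e
    show ξ (a + 1 + l + 2 + (r - 1)) < 2
    rw [show a + 1 + l + 2 + (r - 1) = a + 1 + l + 1 + r by omega, e]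
    exact fwd_s3_lt (h.fwd_pos _)
  · intro t ht
    have e := h.bwd_eq (a + 1 + (l - 1 - t))
    rw [hal _ (by omega)] at e
    show η (a + 1 + l - t) = s2.fwd (η (a + 1 + l - (t + 1)))
    rw [show a + 1 + l - t = a + 1 + (l - 1 - t) + 1 by omega, e,
      show a + 1 + l - (t + 1) = a + 1 + (l - 1 - t) by omega]
    rfl
  · intro t _
    exact (bb _).1
  · have e := h.bwd_eq a
    rw [ha] at e
    show 3 / 2 < η (a + 1 + l - l)
    rw [show a + 1 + l - l = a + 1 by omega, e]
    exact lt_fwd_s3 (h.bwd_pos a)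

end IsOrbit

/-- From `n₀` on, the side sequence is `s4` repeated `2 m` times followed by `s3`, periodically. -/
def IsRunPeriodic (d : ℕ → HexSide) (m n₀ : ℕ) : Prop :=
  ∀ j, (∀ i < 2 * m, d (n₀ + j * (2 * m + 1) + i) = s4) ∧ d (n₀ + j * (2 * m + 1) + 2 * m) = s3

namespace IsOrbit

variable {d : ℕ → HexSide} {ξ η : ℕ → ℝ}

theorem sides_after_s4 (h : IsOrbit d ξ η) (hw : ∀ n, sideWidth (ξ n) (η n) < 4) {n : ℕ}
    (hn : d (n + 1) = s4) (k : ℕ) :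
    d (n + 1 + k) = s4 ∨ (d (n + 1 + k) = s3 ∧ d (n + 1 + k + 1) = s4) := by
  induction k with
  | zero => exact Or.inl hn
  | succ k ih =>
    rcases ih with h4 | ⟨_, h4⟩
    · rcases h.side_cases hw (n + 1 + k + 1) with h2 | h2 | h2
      · exact absurd h2 (h.side_succ_ne_s2 hw h4)
      · refine Or.inr ⟨h2, ?_⟩
        have := h.side_succ_of_s4_s3 hw (n := n + k) (by rwa [show n + k + 1 = n + 1 + k by omega])
          (by rwa [show n + k + 2 = n + 1 + k + 1 by omega])
        rwa [show n + 1 + (k + 1) + 1 = n + k + 3 by omega]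
      · exact Or.inl h2
    · exact Or.inl h4

/-- If s3 recurs, consecutive occurrences enclose finite nonempty runs of s4, and `run_eq_and_even`
carries the length of one run to the next. -/
theorem eventually_of_s4 (h : IsOrbit d ξ η) (hw : ∀ n, sideWidth (ξ n) (η n) < 4) {n : ℕ}
    (hn : d (n + 1) = s4) :
    (∃ N, ∀ k ≥ N, d k = s4) ∨ ∃ m n₀, 1 ≤ m ∧ IsRunPeriodic d m n₀ := by
  have hs := h.sides_after_s4 hw hn
  by_cases hfin : ∃ N, ∀ k ≥ N, d k = s4
  · exact Or.inl hfin
  right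
  push Not at hfin
  have next : ∀ a, n + 1 ≤ a → d a = s3 →
      ∃ l, 1 ≤ l ∧ (∀ i < l, d (a + 1 + i) = s4) ∧ d (a + 1 + l) = s3 := by
    intro a ha h3
    classical
    have hex : ∃ l, d (a + 1 + l) ≠ s4 := by
      obtain ⟨k, hk, hk'⟩ := hfin (a + 1)
      exact ⟨k - (a + 1), by rwa [show a + 1 + (k - (a + 1)) = k by omega]⟩
    have hlt : ∀ i < Nat.find hex, d (a + 1 + i) = s4 := fun i hi => not_not.mp (Nat.find_min hex hi)
    have hsp : d (a + 1 + Nat.find hex) ≠ s4 := Nat.find_spec hex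
    refine ⟨Nat.find hex, ?_, hlt, ?_⟩
    · by_contra h0
      have h0 : Nat.find hex = 0 := by omega
      rw [h0] at hsp
      rcases hs (a - (n + 1)) with h4 | ⟨_, h4⟩
      · rw [show n + 1 + (a - (n + 1)) = a by omega, h3] at h4
        cases h4
      · rw [show n + 1 + (a - (n + 1)) = a by omega] at h4
        exact hsp h4
    · rcases hs (a + Nat.find hex - n) with h4 | ⟨h4, _⟩
      · rw [show n + 1 + (a + Nat.find hex - n) = a + 1 + Nat.find hex by omega] at h4
        exact absurd h4 hsp
      · rwa [show n + 1 + (a + Nat.find hex - n) = a + 1 + Nat.find hex by omega] at h4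
  obtain ⟨a, ha, ha'⟩ := hfin (n + 1)
  have ha3 : d a = s3 := by
    rcases hs (a - (n + 1)) with h4 | ⟨h4, _⟩ <;>
      rw [show n + 1 + (a - (n + 1)) = a by omega] at h4
    · exact absurd h4 ha'
    · exact h4
  obtain ⟨l, hl1, hl2, hl3⟩ := next a ha ha3
  have step : ∀ b, n + 1 ≤ b → d b = s3 → (∀ i < l, d (b + 1 + i) = s4) → d (b + 1 + l) = s3 →
      Even l ∧ (∀ i < l, d (b + 1 + l + 1 + i) = s4) ∧ d (b + 1 + l + 1 + l) = s3 := by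
    intro b hb hb1 hb2 hb3
    obtain ⟨r, hr1, hr2, hr3⟩ := next (b + 1 + l) (by omega) hb3
    obtain ⟨e1, e2⟩ := h.run_eq_and_even hw hl1 hr1 hb1 hb2 hb3 hr2 hr3
    subst e1
    exact ⟨e2, hr2, hr3⟩
  obtain ⟨m, hm⟩ := (step a ha ha3 hl2 hl3).1
  have hm' : l = 2 * m := by omega
  subst hm'
  refine ⟨m, a + 1, by omega, fun j => ?_⟩
  have key : d (a + j * (2 * m + 1)) = s3 ∧ (∀ i < 2 * m, d (a + j * (2 * m + 1) + 1 + i) = s4) ∧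
      d (a + j * (2 * m + 1) + 1 + 2 * m) = s3 := by
    induction j with
    | zero => simpa using ⟨ha3, hl2, hl3⟩
    | succ j ih =>
      obtain ⟨i1, i2, i3⟩ := ih
      obtain ⟨_, j2, j3⟩ := step _ (by omega) i1 i2 i3
      rw [show a + (j + 1) * (2 * m + 1) = a + j * (2 * m + 1) + 1 + 2 * m by ring]
      exact ⟨i3, j2, j3⟩
  rw [show a + 1 + j * (2 * m + 1) = a + j * (2 * m + 1) + 1 by ring]
  exact key.2

/-- The sides crossed by a geodesic all of whose widths are less than four. -/
theorem eventually_sides (h : IsOrbit d ξ η) (hw : ∀ n, sideWidth (ξ n) (η n) < 4) :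
    (∃ N, ∀ k ≥ N, d k = s3) ∨
    ((∃ N, ∀ k ≥ N, d k = s4) ∨ ∃ m n₀, 1 ≤ m ∧ IsRunPeriodic d m n₀) ∨
    ((∃ N, ∀ k ≥ N, (d k).dual = s4) ∨
      ∃ m n₀, 1 ≤ m ∧ IsRunPeriodic (fun n => (d n).dual) m n₀) := by
  by_cases h3 : ∀ k ≥ 1, d k = s3
  · exact Or.inl ⟨1, h3⟩
  push Not at h3
  obtain ⟨k, hk, hk3⟩ := h3
  obtain ⟨n, rfl⟩ : ∃ n, k = n + 1 := ⟨k - 1, by omega⟩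
  rcases h.side_cases hw (n + 1) with h2 | h2 | h2
  · right; right
    exact h.dual.eventually_of_s4 (fun n => by rw [sideWidth_dual]; exact hw n)
      (n := n) (by simp [h2, HexSide.dual])
  · exact absurd h2 hk3
  · exact Or.inr (Or.inl (h.eventually_of_s4 hw h2))

end IsOrbit

/-! ### Limits superior, contraction and the side maps -/

/-- `Λ` is the limit superior of the widths along an orbit. -/
def HasWidthLimsup (ξ η : ℕ → ℝ) (Λ : ℝ) : Prop :=
  (∀ ε > 0, ∀ᶠ n in atTop, sideWidth (ξ n) (η n) < Λ + ε) ∧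
    ∀ ε > 0, ∃ᶠ n in atTop, Λ - ε < sideWidth (ξ n) (η n)

theorem HasWidthLimsup.of_tail {ξ η : ℕ → ℝ} {Λ : ℝ} (N : ℕ)
    (h : HasWidthLimsup (fun n => ξ (N + n)) (fun n => η (N + n)) Λ) : HasWidthLimsup ξ η Λ := by
  refine ⟨fun ε hε => ?_, fun ε hε => ?_⟩
  · obtain ⟨M, hM⟩ := eventually_atTop.mp (h.1 ε hε)
    refine eventually_atTop.mpr ⟨N + M, fun n hn => ?_⟩
    have := hM (n - N) (by omega)
    simpa only [show N + (n - N) = n by omega] using this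
  · refine frequently_atTop.mpr fun M => ?_
    obtain ⟨n, hn, hn'⟩ := frequently_atTop.mp (h.2 ε hε) M
    exact ⟨N + n, by omega, hn'⟩

theorem HasWidthLimsup.of_dual {ξ η : ℕ → ℝ} {Λ : ℝ}
    (h : HasWidthLimsup (fun n => 3 / ξ n) (fun n => 3 / η n) Λ) : HasWidthLimsup ξ η Λ := by
  simpa only [HasWidthLimsup, sideWidth_dual] using h

theorem hasWidthLimsup_of_tendsto {ξ η : ℕ → ℝ} {Λ : ℝ}
    (h : Tendsto (fun n => sideWidth (ξ n) (η n)) atTop (𝓝 Λ)) : HasWidthLimsup ξ η Λ :=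
  ⟨fun _ hε => h.eventually_lt_const (by linarith),
    fun _ hε => (h.eventually_const_lt (by linarith)).frequently⟩

namespace HexSide

theorem abs_fwd_s2_sub {x y : ℝ} (hx : 0 < x) (hy : 0 < y) :
    |s2.fwd x - s2.fwd y| ≤ |x - y| / 4 := by
  have : s2.fwd x - s2.fwd y = -(x - y) / ((x + 2) * (y + 2)) := by
    simp only [fwd]; field_simp; ring
  rw [this, abs_div, abs_neg, abs_of_pos (by positivity : 0 < (x + 2) * (y + 2))]
  exact div_le_div_of_nonneg_left (abs_nonneg _) (by norm_num) (by nlinarith [mul_pos hx hy])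

theorem abs_fwd_s3_sub {x y : ℝ} (hx : 0 < x) (hy : 0 < y) :
    |s3.fwd x - s3.fwd y| ≤ |x - y| / 4 := by
  have : s3.fwd x - s3.fwd y = (x - y) / ((x + 2) * (y + 2)) := by
    simp only [fwd]; field_simp; ring
  rw [this, abs_div, abs_of_pos (by positivity : 0 < (x + 2) * (y + 2))]
  exact div_le_div_of_nonneg_left (abs_nonneg _) (by norm_num) (by nlinarith [mul_pos hx hy])

theorem abs_fwd_s4_sub {x y : ℝ} (hx : 1 ≤ x) (hy : 1 ≤ y) :
    |s4.fwd x - s4.fwd y| ≤ |x - y| / 4 := by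
  have hx1 : 0 < x + 1 := by linarith
  have hy1 : 0 < y + 1 := by linarith
  have : s4.fwd x - s4.fwd y = -(x - y) / ((x + 1) * (y + 1)) := by
    simp only [fwd]; field_simp; ring
  rw [this, abs_div, abs_neg, abs_of_pos (mul_pos hx1 hy1)]
  exact div_le_div_of_nonneg_left (abs_nonneg _) (by norm_num)
    (by nlinarith [mul_nonneg (sub_nonneg.mpr hx) (sub_nonneg.mpr hy)])

theorem one_le_iterate_fwd {t : HexSide} (ht : ∀ x, 1 ≤ x → 1 ≤ t.fwd x) {x : ℝ} (hx : 1 ≤ x)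
    (k : ℕ) : 1 ≤ t.fwd^[k] x := by
  induction k with
  | zero => exact hx
  | succ k ih => rw [Function.iterate_succ_apply']; exact ht _ ih

theorem abs_iterate_fwd_sub {t : HexSide} (ht : ∀ x, 1 ≤ x → 1 ≤ t.fwd x)
    (hc : ∀ x y, 1 ≤ x → 1 ≤ y → |t.fwd x - t.fwd y| ≤ |x - y| / 4) {x y : ℝ} (hx : 1 ≤ x)
    (hy : 1 ≤ y) (k : ℕ) : |t.fwd^[k] x - t.fwd^[k] y| ≤ |x - y| := by
  induction k with
  | zero => exact le_rfl
  | succ k ih =>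
    rw [Function.iterate_succ_apply', Function.iterate_succ_apply']
    have := hc _ _ (one_le_iterate_fwd ht hx k) (one_le_iterate_fwd ht hy k)
    have := abs_nonneg (t.fwd^[k] x - t.fwd^[k] y)
    linarith

theorem one_le_fwd_s2 (x : ℝ) (hx : 1 ≤ x) : 1 ≤ s2.fwd x := (lt_fwd_s2 (by linarith)).le

theorem one_le_fwd_s4 (x : ℝ) (hx : 1 ≤ x) : 1 ≤ s4.fwd x := by
  linarith [lt_fwd_s4 (show 0 < x by linarith)]

theorem abs_iterate_s2_sub {x y : ℝ} (hx : 1 ≤ x) (hy : 1 ≤ y) (k : ℕ) :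
    |s2.fwd^[k] x - s2.fwd^[k] y| ≤ |x - y| :=
  abs_iterate_fwd_sub one_le_fwd_s2
    (fun _ _ hx hy => abs_fwd_s2_sub (by linarith) (by linarith)) hx hy k

theorem abs_iterate_s4_sub {x y : ℝ} (hx : 1 ≤ x) (hy : 1 ≤ y) (k : ℕ) :
    |s4.fwd^[k] x - s4.fwd^[k] y| ≤ |x - y| :=
  abs_iterate_fwd_sub one_le_fwd_s4 (fun _ _ => abs_fwd_s4_sub) hx hy k

theorem iterate_s2_dual {x : ℝ} (hx : 1 ≤ x) (k : ℕ) :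
    3 / s2.fwd^[k] x = s4.fwd^[k] (3 / x) := by
  induction k with
  | zero => rfl
  | succ k ih =>
    rw [Function.iterate_succ_apply', Function.iterate_succ_apply', ← ih]
    have := one_le_iterate_fwd one_le_fwd_s2 hx k
    exact (fwd_dual s2 (by linarith)).symm

end HexSide

/-- The forward endpoint is determined by the future: a bounded error at time n + k shrinks by 4 ^ k
when pulled back to time n, so it vanishes. The backward endpoint only forgets its past, whence mere
convergence in the companion lemma. -/
theorem eq_of_backward_contraction {x : ℕ → ℝ} {z C : ℝ}
    (h : ∀ n, |x n - z| ≤ |x (n + 1) - z| / 4) (hC : ∀ n, |x n - z| ≤ C) (n : ℕ) : x n = z := by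
  have key : ∀ k n, |x n - z| ≤ C * (1 / 4) ^ k := by
    intro k
    induction k with
    | zero => intro n; simpa using hC n
    | succ k ih => intro n; have := h n; have := ih (n + 1); rw [pow_succ]; linarith
  have hlim : Tendsto (fun k : ℕ => C * (1 / 4 : ℝ) ^ k) atTop (𝓝 (C * 0)) :=
    (tendsto_pow_atTop_nhds_zero_of_lt_one (by norm_num) (by norm_num)).const_mul C
  have h0 := ge_of_tendsto' hlim fun k => key k n
  rw [mul_zero] at h0
  exact sub_eq_zero.mp (abs_nonpos_iff.mp h0)

theorem tendsto_of_forward_contraction {y : ℕ → ℝ} {z : ℝ}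
    (h : ∀ n, |y (n + 1) - z| ≤ |y n - z| / 4) : Tendsto y atTop (𝓝 z) := by
  have key : ∀ n, |y n - z| ≤ |y 0 - z| * (1 / 4) ^ n := by
    intro n
    induction n with
    | zero => simp
    | succ k ih => have := h k; rw [pow_succ]; linarith
  have hlim : Tendsto (fun k : ℕ => |y 0 - z| * (1 / 4 : ℝ) ^ k) atTop (𝓝 (|y 0 - z| * 0)) :=
    (tendsto_pow_atTop_nhds_zero_of_lt_one (by norm_num) (by norm_num)).const_mul _
  rw [mul_zero] at hlim
  rw [tendsto_iff_norm_sub_tendsto_zero]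
  exact squeeze_zero (fun _ => norm_nonneg _) key hlim

theorem tendsto_sideWidth {ξ η : ℕ → ℝ} {x y : ℝ} (hx : x ≠ 0) (hy : y ≠ 0)
    (h1 : Tendsto ξ atTop (𝓝 x)) (h2 : Tendsto η atTop (𝓝 y)) :
    Tendsto (fun n => sideWidth (ξ n) (η n)) atTop (𝓝 (sideWidth x y)) :=
  (h1.add h2).max ((tendsto_const_nhds.div h1 hx).add (tendsto_const_nhds.div h2 hy))

/-! ### Bronze numbers and the fixed points of a period -/

/-- The denominators of the convergents of `(3 + √13) / 2`. -/
def bronze : ℕ → ℕ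
  | 0 => 0
  | 1 => 1
  | n + 2 => 3 * bronze (n + 1) + bronze n

theorem bronze_add_two (n : ℕ) : bronze (n + 2) = 3 * bronze (n + 1) + bronze n := rfl

theorem bronze_lt_succ_succ (n : ℕ) : bronze (n + 1) < bronze (n + 2) := by
  induction n with
  | zero => decide
  | succ n ih =>
    show bronze (n + 2) < 3 * bronze (n + 2) + bronze (n + 1)
    omega

theorem bronze_odd_strictMono : StrictMono fun m => bronze (2 * m + 1) := by
  refine strictMono_nat_of_lt_succ fun m => ?_
  exact (bronze_lt_succ_succ (2 * m)).trans (bronze_lt_succ_succ (2 * m + 1))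

theorem one_le_bronze_odd (m : ℕ) : 1 ≤ bronze (2 * m + 1) :=
  bronze_odd_strictMono.monotone (Nat.zero_le m)

theorem ten_le_bronze_odd {m : ℕ} (hm : 1 ≤ m) : 10 ≤ bronze (2 * m + 1) :=
  bronze_odd_strictMono.monotone hm

/-- The Cassini identity for the recursion t² = 3t + 1; the restriction to odd leading index fixes
the sign. -/
theorem bronze_norm (m : ℕ) :
    (bronze (2 * m + 1) : ℝ) ^ 2 - 3 * bronze (2 * m) * bronze (2 * m + 1) - (bronze (2 * m)) ^ 2 =
      1 := by
  induction m with
  | zero => simp [bronze]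
  | succ m ih =>
    rw [show 2 * (m + 1) + 1 = 2 * m + 1 + 2 by ring, show 2 * (m + 1) = 2 * m + 2 by ring,
      bronze_add_two, bronze_add_two]
    push_cast
    linear_combination ih

/-- The matrix of `s4.fwd` has trace 3 and determinant -1, so by Cayley–Hamilton its powers obey the
bronze recursion. The same holds for `s2.fwd`. -/
theorem iterate_s4 {x : ℝ} (hx : 1 ≤ x) (k : ℕ) :
    s4.fwd^[k] x = (((bronze (k + 1) : ℝ) - bronze k) * x + 3 * bronze k) /
      (bronze k * x + (bronze (k + 1) - 2 * bronze k)) ∧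
    0 < bronze k * x + ((bronze (k + 1) : ℝ) - 2 * bronze k) := by
  induction k with
  | zero => simp [bronze]
  | succ k ih =>
    obtain ⟨h1, h2⟩ := ih
    have h3 := one_le_iterate_fwd one_le_fwd_s4 hx k
    have e : (bronze (k + 1) : ℝ) * x + (bronze (k + 1 + 1) - 2 * bronze (k + 1)) =
        (((bronze (k + 1) : ℝ) - bronze k) * x + 3 * bronze k) +
          (bronze k * x + (bronze (k + 1) - 2 * bronze k)) := by
      rw [bronze_add_two]; push_cast; ring
    rw [h1, le_div_iff₀ h2] at h3
    have h4 : 0 < (bronze (k + 1) : ℝ) * x + (bronze (k + 1 + 1) - 2 * bronze (k + 1)) := by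
      rw [e]; linarith
    refine ⟨?_, h4⟩
    rw [Function.iterate_succ_apply', h1]
    simp only [fwd]
    rw [e] at h4 ⊢
    rw [div_add_one h2.ne', mul_div_assoc', div_add' _ _ _ h2.ne', div_div_div_cancel_right₀ h2.ne',
      bronze_add_two]
    congr 1
    push_cast
    ring

theorem iterate_s2 {x : ℝ} (hx : 1 ≤ x) (k : ℕ) :
    s2.fwd^[k] x = (((bronze (k + 1) : ℝ) - 2 * bronze k) * x + 3 * bronze k) /
      (bronze k * x + (bronze (k + 1) - bronze k)) ∧
    0 < bronze k * x + ((bronze (k + 1) : ℝ) - bronze k) := by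
  induction k with
  | zero => simp [bronze]
  | succ k ih =>
    obtain ⟨h1, h2⟩ := ih
    have h3 := one_le_iterate_fwd one_le_fwd_s2 hx k
    have e : (bronze (k + 1) : ℝ) * x + (bronze (k + 1 + 1) - bronze (k + 1)) =
        (((bronze (k + 1) : ℝ) - 2 * bronze k) * x + 3 * bronze k) +
          2 * (bronze k * x + (bronze (k + 1) - bronze k)) := by
      rw [bronze_add_two]; push_cast; ring
    rw [h1, le_div_iff₀ h2] at h3
    have h4 : 0 < (bronze (k + 1) : ℝ) * x + (bronze (k + 1 + 1) - bronze (k + 1)) := by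
      rw [e]; linarith
    refine ⟨?_, h4⟩
    rw [Function.iterate_succ_apply', h1]
    simp only [fwd]
    rw [e] at h4 ⊢
    rw [div_add' _ _ _ h2.ne', div_add' _ _ _ h2.ne', div_div_div_cancel_right₀ h2.ne',
      bronze_add_two]
    congr 1
    push_cast
    ring

/-- The attracting fixed point of `s4.fwd^[2 * m] ∘ s3.fwd`. -/
noncomputable def runFwd (m : ℕ) : ℝ :=
  (bronze (2 * m) + √(4 * bronze (2 * m + 1) ^ 2 - 1)) / bronze (2 * m + 1)

/-- The attracting fixed point of `s3.fwd ∘ s2.fwd^[2 * m]`. -/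
noncomputable def runBwd (m : ℕ) : ℝ :=
  (-bronze (2 * m) + √(4 * bronze (2 * m + 1) ^ 2 - 1)) / bronze (2 * m + 1)

/-- The limits superior of the widths which are less than four, in increasing order. -/
noncomputable def widthSeq : ℕ → ℝ
  | 0 => 2 * √3
  | 1 => √13
  | j + 2 => 2 * √(4 - 1 / (bronze (2 * j + 3) : ℝ) ^ 2)

theorem bronze_odd_pos (m : ℕ) : (0 : ℝ) < bronze (2 * m + 1) := by
  exact_mod_cast one_le_bronze_odd m

theorem bronze_odd_cast (m : ℕ) : (1 : ℝ) ≤ bronze (2 * m + 1) := by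
  exact_mod_cast one_le_bronze_odd m

theorem three_mul_bronze_le (m : ℕ) : 3 * (bronze (2 * m) : ℝ) ≤ bronze (2 * m + 1) := by
  have h := bronze_norm m
  have h1 := bronze_odd_pos m
  have h2 : (0 : ℝ) ≤ bronze (2 * m) := Nat.cast_nonneg _
  by_contra h3
  push Not at h3
  nlinarith

theorem runFwd_add_runBwd {m : ℕ} (hm : 1 ≤ m) : runFwd m + runBwd m = widthSeq (m + 1) := by
  obtain ⟨j, rfl⟩ : ∃ j, m = j + 1 := ⟨m - 1, by omega⟩
  have hb := bronze_odd_pos (j + 1)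
  rw [runFwd, runBwd, ← add_div]
  simp only [widthSeq]
  rw [show 2 * (j + 1) + 1 = 2 * j + 3 by ring] at hb ⊢
  have : (4 - 1 / (bronze (2 * j + 3) : ℝ) ^ 2) =
      (4 * (bronze (2 * j + 3) : ℝ) ^ 2 - 1) / (bronze (2 * j + 3) : ℝ) ^ 2 := by field_simp
  rw [this, Real.sqrt_div' _ (by positivity), Real.sqrt_sq hb.le]
  ring

theorem sq_sqrt_run (m : ℕ) : √(4 * (bronze (2 * m + 1) : ℝ) ^ 2 - 1) ^ 2 =
    4 * (bronze (2 * m + 1) : ℝ) ^ 2 - 1 :=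
  Real.sq_sqrt (by nlinarith [bronze_odd_cast m])

theorem lt_sqrt_run (m : ℕ) : 5 / 3 * (bronze (2 * m + 1) : ℝ) <
    √(4 * (bronze (2 * m + 1) : ℝ) ^ 2 - 1) :=
  Real.lt_sqrt_of_sq_lt (by nlinarith [bronze_odd_cast m])

theorem one_lt_runBwd (m : ℕ) : 1 < runBwd m := by
  rw [runBwd, lt_div_iff₀ (bronze_odd_pos m)]
  linarith [lt_sqrt_run m, three_mul_bronze_le m, bronze_odd_pos m]

theorem one_lt_runFwd (m : ℕ) : 1 < runFwd m := by
  rw [runFwd, lt_div_iff₀ (bronze_odd_pos m)]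
  have : (0 : ℝ) ≤ bronze (2 * m) := Nat.cast_nonneg _
  linarith [lt_sqrt_run m, bronze_odd_pos m]

theorem runFwd_fixed (m : ℕ) : s4.fwd^[2 * m] (s3.fwd (runFwd m)) = runFwd m := by
  have hX := one_lt_runFwd m
  have h3 : 1 ≤ s3.fwd (runFwd m) := by linarith [lt_fwd_s3 (show 0 < runFwd m by linarith)]
  obtain ⟨h1, h2⟩ := iterate_s4 h3 (2 * m)
  rw [h1, div_eq_iff h2.ne']
  have hb := bronze_odd_pos m
  -- The fixed point equation of the period; by `bronze_norm` a quarter of its discriminant is 4B² -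
  -- 1 with B = `bronze (2 * m + 1)`.
  have hq : bronze (2 * m + 1) * runFwd m ^ 2 - 2 * bronze (2 * m) * runFwd m -
      (3 * bronze (2 * m) + 3 * bronze (2 * m + 1)) = 0 := by
    rw [runFwd]
    have hS := sq_sqrt_run m
    generalize √(4 * (bronze (2 * m + 1) : ℝ) ^ 2 - 1) = S at hS
    field_simp
    linear_combination hS + bronze_norm m
  have : runFwd m + 2 ≠ 0 := by linarith
  simp only [fwd]
  field_simp
  linear_combination -hq

theorem runBwd_fixed (m : ℕ) : s3.fwd (s2.fwd^[2 * m] (runBwd m)) = runBwd m := by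
  have hX := one_lt_runBwd m
  obtain ⟨h1, h2⟩ := iterate_s2 hX.le (2 * m)
  have h3 := one_le_iterate_fwd one_le_fwd_s2 hX.le (2 * m)
  simp only [fwd]
  rw [div_eq_iff (by linarith)]
  have hb := bronze_odd_pos m
  have hq : bronze (2 * m + 1) * runBwd m ^ 2 + 2 * bronze (2 * m) * runBwd m -
      (3 * bronze (2 * m) + 3 * bronze (2 * m + 1)) = 0 := by
    rw [runBwd]
    have hS := sq_sqrt_run m
    generalize √(4 * (bronze (2 * m + 1) : ℝ) ^ 2 - 1) = S at hS
    field_simp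
    linear_combination hS + bronze_norm m
  rw [h1]
  field_simp
  linear_combination -hq

/-- The width seen at the end of a run of `s4` equals the width seen at its beginning. -/
theorem run_dual (m : ℕ) : 3 / s3.fwd (runFwd m) + 3 / s2.fwd^[2 * m] (runBwd m) =
    runFwd m + runBwd m := by
  have hX := one_lt_runFwd m
  have hY := one_lt_runBwd m
  set Y' := s2.fwd^[2 * m] (runBwd m) with hY'
  have hY1 : 1 ≤ Y' := one_le_iterate_fwd one_le_fwd_s2 hY.le _
  have e1 : 3 / runBwd m = s3.fwd (3 / Y') := by
    rw [← runBwd_fixed m, ← hY']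
    exact (fwd_dual s3 (by linarith)).symm
  -- So 3/Y' is fixed by the same contracting map as `runFwd m`, and the two coincide.
  have e2 : 3 / Y' = s4.fwd^[2 * m] (s3.fwd (3 / Y')) := by
    rw [← e1, ← iterate_s2_dual hY.le]
  have hp : 0 < 3 / Y' := by positivity
  have e3 : 3 / Y' = runFwd m := by
    have h1 : |3 / Y' - runFwd m| ≤ |s3.fwd (3 / Y') - s3.fwd (runFwd m)| := by
      have a1 := lt_fwd_s3 hp
      have a2 := lt_fwd_s3 (show 0 < runFwd m by linarith)
      have := abs_iterate_s4_sub (x := s3.fwd (3 / Y')) (y := s3.fwd (runFwd m)) (by linarith)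
        (by linarith) (2 * m)
      rwa [← e2, runFwd_fixed] at this
    have h2 := abs_fwd_s3_sub hp (show 0 < runFwd m by linarith)
    have h3 := abs_nonneg (3 / Y' - runFwd m)
    exact sub_eq_zero.mp (abs_eq_zero.mp (by linarith))
  have e4 : 3 / s3.fwd (runFwd m) = runBwd m := by
    rw [← e3, ← e1, div_div_cancel₀ (by norm_num)]
  rw [e3, e4, add_comm]

/-! ### The limit superior for each kind of side sequence -/

namespace IsOrbit

variable {d : ℕ → HexSide} {ξ η : ℕ → ℝ}

theorem hasWidthLimsup_of_s3 (h : IsOrbit d ξ η) {N : ℕ} (hd : ∀ k ≥ N, d k = s3) :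
    HasWidthLimsup ξ η (widthSeq 0) := by
  apply HasWidthLimsup.of_tail N
  have h' := h.tail N
  have hs : √3 ^ 2 = 3 := Real.sq_sqrt (by norm_num)
  have hs0 : 0 < √3 := by positivity
  have fx : s3.fwd (√3) = √3 := by
    simp only [fwd]; rw [div_eq_iff (by positivity)]; linear_combination -hs
  have h1 : ∀ n, ξ (N + n) = √3 := by
    refine eq_of_backward_contraction (C := 3) (fun n => ?_) (fun n => ?_)
    · have := h.fwd_eq (N + n)
      rw [hd _ (by omega)] at this
      rw [this]
      nth_rw 1 [← fx]
      exact abs_fwd_s3_sub (h.fwd_pos _) hs0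
    · have := h.fwd_eq (N + n)
      rw [hd _ (by omega)] at this
      have a := lt_fwd_s3 (h.fwd_pos (N + n + 1))
      have b := fwd_s3_lt (h.fwd_pos (N + n + 1))
      have c : √3 < 2 := by nlinarith
      rw [this, abs_le]
      constructor <;> linarith
  have h2 : Tendsto (fun n => η (N + n)) atTop (𝓝 √3) := by
    refine tendsto_of_forward_contraction fun n => ?_
    have := h.bwd_eq (N + n)
    rw [hd _ (by omega)] at this
    change |η (N + n + 1) - _| ≤ _
    rw [this]
    nth_rw 1 [← fx]
    exact abs_fwd_s3_sub (h.bwd_pos _) hs0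
  have h3 := tendsto_sideWidth hs0.ne' hs0.ne' (tendsto_const_nhds (x := √3)) h2
  apply hasWidthLimsup_of_tendsto
  simp only [h1]
  convert h3 using 2
  have : 3 / √3 = √3 := by rw [div_eq_iff hs0.ne']; linear_combination -hs
  rw [sideWidth, this, max_self, widthSeq]
  ring

theorem hasWidthLimsup_of_s4 (h : IsOrbit d ξ η) {N : ℕ} (hd : ∀ k ≥ N, d k = s4) :
    HasWidthLimsup ξ η (widthSeq 1) := by
  apply HasWidthLimsup.of_tail N
  have hs : √13 ^ 2 = 13 := Real.sq_sqrt (by norm_num)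
  have hs0 : 3 < √13 := Real.lt_sqrt_of_sq_lt (by norm_num)
  have hs1 : √13 < 4 := by nlinarith
  have fx : s4.fwd ((1 + √13) / 2) = (1 + √13) / 2 := by
    simp only [fwd]; rw [div_eq_iff (by positivity)]; linear_combination -hs / 4
  have fy : s2.fwd ((-1 + √13) / 2) = (-1 + √13) / 2 := by
    simp only [fwd]; rw [div_eq_iff (by linarith)]; linear_combination -hs / 4
  have hb : ∀ n, 2 < ξ (N + n) ∧ ξ (N + n) < 3 := by
    intro n
    have := h.fwd_eq (N + n)
    rw [hd _ (by omega)] at this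
    rw [this]
    exact ⟨lt_fwd_s4 (h.fwd_pos _), fwd_s4_lt (h.fwd_pos _)⟩
  have h1 : ∀ n, ξ (N + n) = (1 + √13) / 2 := by
    refine eq_of_backward_contraction (C := 3) (fun n => ?_) (fun n => ?_)
    · have := h.fwd_eq (N + n)
      rw [hd _ (by omega)] at this
      rw [this]
      nth_rw 1 [← fx]
      exact abs_fwd_s4_sub (by have := (hb (n + 1)).1; rw [← add_assoc] at this; linarith) (by linarith)
    · have := hb n
      rw [abs_le]
      constructor <;> linarith
  have h2 : Tendsto (fun n => η (N + n)) atTop (𝓝 ((-1 + √13) / 2)) := by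
    refine tendsto_of_forward_contraction fun n => ?_
    have := h.bwd_eq (N + n)
    rw [hd _ (by omega)] at this
    change |η (N + n + 1) - _| ≤ _
    rw [this]
    nth_rw 1 [← fy]
    exact abs_fwd_s2_sub (h.bwd_pos _) (by linarith)
  have h3 := tendsto_sideWidth (by linarith) (by linarith)
    (tendsto_const_nhds (x := (1 + √13) / 2)) h2
  apply hasWidthLimsup_of_tendsto
  simp only [h1]
  convert h3 using 2
  have : 3 / ((1 + √13) / 2) + 3 / ((-1 + √13) / 2) = √13 := by
    have e1 : 1 + √13 ≠ 0 := by linarith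
    have e2 : -1 + √13 ≠ 0 := by linarith
    field_simp
    linear_combination (-√13) * hs
  rw [sideWidth, this, widthSeq]
  rw [max_eq_right (by linarith)]

theorem fwd_eq_iterate (h : IsOrbit d ξ η) {a k : ℕ} {t : HexSide} (hd : ∀ i < k, d (a + i) = t) :
    ξ a = t.fwd^[k] (ξ (a + k)) := by
  induction k with
  | zero => rfl
  | succ k ih =>
    rw [ih fun i hi => hd i (by omega), Function.iterate_succ_apply, h.fwd_eq (a + k),
      hd k (by omega)]
    rfl

theorem bwd_eq_iterate (h : IsOrbit d ξ η) {a k : ℕ} {t : HexSide} (hd : ∀ i < k, d (a + i) = t) :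
    η (a + k) = t.rev.fwd^[k] (η a) := by
  induction k with
  | zero => rfl
  | succ k ih =>
    rw [Function.iterate_succ_apply', ← ih fun i hi => hd i (by omega), ← hd k (by omega)]
    exact h.bwd_eq _

theorem bounds_of_s3_or_s4 (h : IsOrbit d ξ η) {n : ℕ} (hd : d n = s3 ∨ d n = s4) :
    3 / 2 < ξ n ∧ ξ n < 3 ∧ 1 < η (n + 1) ∧ η (n + 1) < 2 := by
  have e1 := h.fwd_eq n
  have e2 := h.bwd_eq n
  have p1 := h.fwd_pos (n + 1)
  have p2 := h.bwd_pos n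
  rcases hd with hd | hd <;> rw [hd] at e1 e2 <;> rw [e1, e2]
  · have : s3.rev = s3 := rfl
    rw [this]
    exact ⟨lt_fwd_s3 p1, by linarith [fwd_s3_lt p1], by linarith [lt_fwd_s3 p2], fwd_s3_lt p2⟩
  · have : s4.rev = s2 := rfl
    rw [this]
    exact ⟨by linarith [lt_fwd_s4 p1], fwd_s4_lt p1, lt_fwd_s2 p2, by linarith [fwd_s2_lt p2]⟩

/-- Inside a run of s4 both widths stay away from four, and by `lt_widthSeq` below the limit claimed
for periodic runs. Only the ends of the runs contribute. -/
theorem sideWidth_lt_of_s4_s4 (h : IsOrbit d ξ η) {n : ℕ} (h0 : d n = s3 ∨ d n = s4)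
    (h1 : d (n + 1) = s4) (h2 : d (n + 2) = s4) (h3 : d (n + 3) = s3 ∨ d (n + 3) = s4) :
    sideWidth (ξ (n + 2)) (η (n + 2)) < 39 / 10 := by
  have b0 := h.bounds_of_s3_or_s4 h0
  have b3 := h.bounds_of_s3_or_s4 h3
  have e1 := h.fwd_eq (n + 2)
  have e2 : η (n + 2) = s2.fwd (η (n + 1)) := by rw [h.bwd_eq (n + 1), h1]; rfl
  rw [h2, fwd_s4_eq (h.fwd_pos _)] at e1
  rw [fwd_s2_eq (h.bwd_pos _)] at e2
  have c1 : 1 / (ξ (n + 2 + 1) + 1) < 2 / 5 := by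
    rw [div_lt_div_iff₀ (by linarith) (by norm_num)]
    linarith [b3.1]
  have c2 : 1 / (η (n + 1) + 2) < 1 / 2 := by
    rw [div_lt_div_iff₀ (by linarith) (by norm_num)]
    linarith [b0.2.2.1]
  have c3 : 1 / 4 < 1 / (η (n + 1) + 2) := by
    rw [div_lt_div_iff₀ (by norm_num) (by linarith)]
    linarith [b0.2.2.2]
  have c4 : 0 < 1 / (ξ (n + 2 + 1) + 1) := by
    have := h.fwd_pos (n + 2 + 1)
    positivity
  rw [sideWidth, max_lt_iff]
  refine ⟨by linarith, ?_⟩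
  have f1 : 3 / ξ (n + 2) < 3 / 2 := by rw [div_lt_iff₀ (h.fwd_pos _)]; linarith
  have f2 : 3 / η (n + 2) < 12 / 5 := by rw [div_lt_iff₀ (h.bwd_pos _)]; linarith
  linarith

theorem lt_widthSeq (j : ℕ) : 39 / 10 < widthSeq (j + 2) := by
  have h10 : (10 : ℝ) ≤ bronze (2 * j + 3) := by
    exact_mod_cast ten_le_bronze_odd (m := j + 1) (by omega)
  have h1 : 39 / 20 < √(4 - 1 / (bronze (2 * j + 3) : ℝ) ^ 2) := by
    apply Real.lt_sqrt_of_sq_lt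
    have : 1 / (bronze (2 * j + 3) : ℝ) ^ 2 ≤ 1 / 100 := by
      apply one_div_le_one_div_of_le (by norm_num)
      nlinarith
    linarith
  simp only [widthSeq]
  linarith

/-- At the beginning p j of every run ξ equals `runFwd m`, and η tends to `runBwd m`. The widths at
the two ends of a run have the same limit by `run_dual`. -/
theorem hasWidthLimsup_of_isRunPeriodic (h : IsOrbit d ξ η) {m n₀ : ℕ} (hm : 1 ≤ m)
    (hd : IsRunPeriodic d m n₀) : HasWidthLimsup ξ η (widthSeq (m + 1)) := by
  have hΛ := runFwd_add_runBwd hm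
  have hΛ' : 39 / 10 < widthSeq (m + 1) := by
    obtain ⟨j, rfl⟩ : ∃ j, m = j + 1 := ⟨m - 1, by omega⟩
    exact lt_widthSeq j
  have hX := one_lt_runFwd m
  have hY := one_lt_runBwd m
  have h34 : ∀ n ≥ n₀, d n = s3 ∨ d n = s4 := by
    intro n hn
    have e := Nat.div_add_mod (n - n₀) (2 * m + 1)
    have hlt := Nat.mod_lt (n - n₀) (show 0 < 2 * m + 1 by omega)
    obtain ⟨g1, g2⟩ := hd ((n - n₀) / (2 * m + 1))
    have e' : n = n₀ + (n - n₀) / (2 * m + 1) * (2 * m + 1) + (n - n₀) % (2 * m + 1) := by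
      rw [mul_comm] at e; omega
    rcases Nat.lt_or_ge ((n - n₀) % (2 * m + 1)) (2 * m) with h1 | h1
    · right; rw [e']; exact g1 _ h1
    · left; rw [e', show (n - n₀) % (2 * m + 1) = 2 * m by omega]; exact g2
  have hbd := fun n (hn : n ≥ n₀) => h.bounds_of_s3_or_s4 (h34 n hn)
  set p : ℕ → ℕ := fun j => n₀ + j * (2 * m + 1) with hp
  have hps : ∀ j, p (j + 1) = p j + 2 * m + 1 := fun j => by simp only [hp]; ring
  have hpn : ∀ j, n₀ ≤ p j := fun j => by simp only [hp]; omega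
  have xstep : ∀ j, ξ (p j) = s4.fwd^[2 * m] (s3.fwd (ξ (p (j + 1)))) := by
    intro j
    rw [h.fwd_eq_iterate (hd j).1, hps, h.fwd_eq (n₀ + j * (2 * m + 1) + 2 * m), (hd j).2]
  have ymid : ∀ j, η (p j + 2 * m) = s2.fwd^[2 * m] (η (p j)) := fun j =>
    h.bwd_eq_iterate (hd j).1
  have ystep : ∀ j, η (p (j + 1)) = s3.fwd (η (p j + 2 * m)) := by
    intro j
    rw [hps, h.bwd_eq, (hd j).2]
    rfl
  have hx : ∀ j, ξ (p j) = runFwd m := by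
    refine eq_of_backward_contraction (C := 3 + runFwd m) (fun j => ?_) (fun j => ?_)
    · have a := (hbd (p (j + 1)) (hpn _)).1
      have a1 := lt_fwd_s3 (show 0 < ξ (p (j + 1)) by linarith)
      have a2 := lt_fwd_s3 (show 0 < runFwd m by linarith)
      have h1 := abs_iterate_s4_sub (x := s3.fwd (ξ (p (j + 1)))) (y := s3.fwd (runFwd m))
        (by linarith) (by linarith) (2 * m)
      rw [runFwd_fixed, ← xstep] at h1
      exact h1.trans (abs_fwd_s3_sub (by linarith) (by linarith))
    · have a := hbd (p j) (hpn j)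
      rw [abs_le]
      constructor <;> linarith [a.1, a.2.1]
  -- At p 0 the backward endpoint is only known to be positive; from the next period on it is an
  -- image under s3 and exceeds 1, where the iterates of s2 can be compared.
  have hy1 : ∀ j, 1 ≤ η (p (j + 1)) := fun j => by
    rw [ystep]; linarith [lt_fwd_s3 (h.bwd_pos (p j + 2 * m))]
  have hymid : ∀ j, |η (p (j + 1) + 2 * m) - s2.fwd^[2 * m] (runBwd m)| ≤
      |η (p (j + 1)) - runBwd m| := fun j => by
    rw [ymid]; exact abs_iterate_s2_sub (hy1 j) hY.le _
  have hy : Tendsto (fun j => η (p (j + 1))) atTop (𝓝 (runBwd m)) := by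
    refine tendsto_of_forward_contraction fun j => ?_
    have h1 := one_le_iterate_fwd one_le_fwd_s2 hY.le (2 * m)
    have h2 := abs_fwd_s3_sub (h.bwd_pos (p (j + 1) + 2 * m))
      (show 0 < s2.fwd^[2 * m] (runBwd m) by linarith)
    rw [← ystep, runBwd_fixed] at h2
    linarith [hymid j]
  have hy' : Tendsto (fun j => η (p (j + 1) + 2 * m)) atTop (𝓝 (s2.fwd^[2 * m] (runBwd m))) := by
    rw [tendsto_iff_norm_sub_tendsto_zero] at hy ⊢
    exact squeeze_zero (fun _ => norm_nonneg _) hymid hy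
  have hY' := one_le_iterate_fwd one_le_fwd_s2 hY.le (2 * m)
  have hdual : Tendsto (fun j => 3 / s3.fwd (runFwd m) + 3 / η (p (j + 1) + 2 * m)) atTop
      (𝓝 (widthSeq (m + 1))) := by
    rw [← hΛ, ← run_dual]
    exact tendsto_const_nhds.add (tendsto_const_nhds.div hy' (by linarith))
  have hsum : Tendsto (fun j => runFwd m + η (p (j + 1))) atTop (𝓝 (widthSeq (m + 1))) := by
    rw [← hΛ]
    exact tendsto_const_nhds.add hy
  refine ⟨fun ε hε => ?_, fun ε hε => ?_⟩
  · obtain ⟨J, hJ⟩ := eventually_atTop.mp ((hdual.eventually_lt_const (lt_add_of_pos_right _ hε)).and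
      (hsum.eventually_lt_const (lt_add_of_pos_right _ hε)))
    refine eventually_atTop.mpr ⟨n₀ + (J + 1) * (2 * m + 1), fun n hn => ?_⟩
    have e := Nat.div_add_mod (n - n₀) (2 * m + 1)
    have hlt := Nat.mod_lt (n - n₀) (show 0 < 2 * m + 1 by omega)
    have hq : J + 1 ≤ (n - n₀) / (2 * m + 1) := by
      rw [Nat.le_div_iff_mul_le (by omega)]; omega
    obtain ⟨j, hj⟩ : ∃ j, (n - n₀) / (2 * m + 1) = j + 1 := ⟨(n - n₀) / (2 * m + 1) - 1, by omega⟩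
    set i := (n - n₀) % (2 * m + 1) with hi
    have en : n = p (j + 1) + i := by
      simp only [hp]; rw [hj, mul_comm] at e
      have : n₀ ≤ n := by
        have : 0 ≤ (J + 1) * (2 * m + 1) := Nat.zero_le _
        omega
      omega
    obtain ⟨J1, J2⟩ := hJ j (by omega)
    have hpos : 2 ≤ p (j + 1) ∧ n₀ ≤ p (j + 1) - 2 := by
      have := hps j
      have := hpn j
      omega
    -- The first width at i = 0 and the second at i = 2m tend to Λ; the other width at these two
    -- places is below 7/2, and all widths in between are below 39/10.
    rcases Nat.eq_zero_or_pos i with h0 | h0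
    · rw [en, h0, add_zero, sideWidth, max_lt_iff, hx]
      refine ⟨J2, ?_⟩
      have e1 := h.fwd_eq (p (j + 1))
      have hd0 : d (p (j + 1)) = s4 := by simpa using (hd (j + 1)).1 0 (by omega)
      rw [hx, hd0] at e1
      have a1 := lt_fwd_s4 (h.fwd_pos (p (j + 1) + 1))
      have a2 := lt_fwd_s3 (h.bwd_pos (p j + 2 * m))
      rw [← e1] at a1
      rw [← ystep] at a2
      have c1 : 3 / runFwd m < 3 / 2 := by rw [div_lt_iff₀ (by linarith)]; linarith
      have c2 : 3 / η (p (j + 1)) < 2 := by rw [div_lt_iff₀ (by linarith)]; linarith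
      linarith
    · rcases Nat.lt_or_ge i (2 * m) with h1 | h1
      · have := h.sideWidth_lt_of_s4_s4 (n := n - 2) (h34 _ (by omega)) ?_ ?_ (h34 _ (by omega))
        · rw [show n - 2 + 2 = n by omega] at this
          linarith
        · rw [show n - 2 + 1 = p (j + 1) + (i - 1) by omega]
          exact (hd (j + 1)).1 _ (by omega)
        · rw [show n - 2 + 2 = p (j + 1) + i by omega]
          exact (hd (j + 1)).1 _ h1
      · have h2 : i = 2 * m := by omega
        have e1 : ξ n = s3.fwd (runFwd m) := by
          rw [en, h2, h.fwd_eq, ← hps, hx]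
          exact congrArg (fun t => HexSide.fwd t _) (hd (j + 1)).2
        rw [sideWidth, max_lt_iff]
        refine ⟨?_, by rw [e1, en, h2]; exact J1⟩
        have a1 := fwd_s3_lt (show 0 < runFwd m by linarith)
        have a2 := (hbd (n - 1) (by omega)).2.2.2
        rw [show n - 1 + 1 = n by omega] at a2
        have hd4 : d (n - 1) = s4 := by
          rw [show n - 1 = p (j + 1) + (2 * m - 1) by omega]
          exact (hd (j + 1)).1 _ (by omega)
        have e2 := h.bwd_eq (n - 1)
        rw [show n - 1 + 1 = n by omega, hd4] at e2
        have a3 : s4.rev.fwd (η (n - 1)) < 3 / 2 := fwd_s2_lt (h.bwd_pos _)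
        linarith
  · refine frequently_atTop.mpr fun M => ?_
    obtain ⟨J, hJ⟩ := eventually_atTop.mp (hsum.eventually_const_lt (sub_lt_self _ hε))
    refine ⟨p (max J M + 1), ?_, ?_⟩
    · have : max J M * 1 ≤ max J M * (2 * m + 1) := Nat.mul_le_mul_left _ (by omega)
      have h2 := le_max_right J M
      simp only [hp]
      rw [add_mul]
      omega
    · refine lt_of_lt_of_le (hJ (max J M) (le_max_left _ _)) ?_
      rw [sideWidth, hx]
      exact le_max_left _ _

/-- The possible limits superior of the widths below four. -/
theorem exists_hasWidthLimsup (h : IsOrbit d ξ η)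
    (hw : ∀ᶠ n in atTop, sideWidth (ξ n) (η n) < 4) : ∃ j, HasWidthLimsup ξ η (widthSeq j) := by
  obtain ⟨N, hN⟩ := eventually_atTop.mp hw
  have ht := h.tail N
  rcases ht.eventually_sides (fun n => hN _ (by omega)) with
    ⟨M, hM⟩ | (⟨M, hM⟩ | ⟨m, n₀, hm, hp⟩) | (⟨M, hM⟩ | ⟨m, n₀, hm, hp⟩)
  · exact ⟨_, (ht.hasWidthLimsup_of_s3 hM).of_tail⟩
  · exact ⟨_, (ht.hasWidthLimsup_of_s4 hM).of_tail⟩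
  · exact ⟨_, (ht.hasWidthLimsup_of_isRunPeriodic hm hp).of_tail⟩
  · exact ⟨_, (ht.dual.hasWidthLimsup_of_s4 hM).of_dual.of_tail⟩
  · exact ⟨_, (ht.dual.hasWidthLimsup_of_isRunPeriodic hm hp).of_dual.of_tail⟩

end IsOrbit

/-! ### The sequence of limits superior -/

theorem widthSeq_strictMono : StrictMono widthSeq := by
  refine strictMono_nat_of_lt_succ fun j => ?_
  match j with
  | 0 =>
    simp only [widthSeq]
    rw [show (2 : ℝ) = √4 by rw [show (4 : ℝ) = 2 ^ 2 by norm_num, Real.sqrt_sq (by norm_num)],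
      ← Real.sqrt_mul (by norm_num)]
    exact Real.sqrt_lt_sqrt (by norm_num) (by norm_num)
  | 1 =>
    refine lt_trans ?_ (IsOrbit.lt_widthSeq 0)
    simp only [widthSeq]
    rw [Real.sqrt_lt' (by norm_num)]
    norm_num
  | j + 2 =>
    simp only [widthSeq]
    have h1 : (bronze (2 * j + 3) : ℝ) < bronze (2 * (j + 1) + 3) := by
      exact_mod_cast bronze_odd_strictMono (show j + 1 < j + 2 by omega)
    have h0 : (1 : ℝ) ≤ bronze (2 * j + 3) := bronze_odd_cast (j + 1)
    have h2 : 1 / (bronze (2 * j + 3) : ℝ) ^ 2 ≤ 1 := by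
      rw [div_le_one (by positivity)]; nlinarith
    have h3 : 1 / (bronze (2 * (j + 1) + 3) : ℝ) ^ 2 < 1 / (bronze (2 * j + 3) : ℝ) ^ 2 :=
      one_div_lt_one_div_of_lt (by positivity) (by nlinarith)
    have := Real.sqrt_lt_sqrt (by linarith) (sub_lt_sub_left h3 4)
    linarith

theorem widthSeq_tendsto : Tendsto widthSeq atTop (𝓝 4) := by
  rw [← tendsto_add_atTop_iff_nat 2]
  have h1 : Tendsto (fun j => (bronze (2 * j + 3) : ℝ)) atTop atTop := by
    refine tendsto_natCast_atTop_atTop.comp ?_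
    exact (bronze_odd_strictMono.comp (strictMono_id.add_const 1)).tendsto_atTop
  have h2 : Tendsto (fun j => 2 * √(4 - 1 / (bronze (2 * j + 3) : ℝ) ^ 2)) atTop
      (𝓝 (2 * √(4 - 0))) := by
    refine ((Real.continuous_sqrt.tendsto _).comp (tendsto_const_nhds.sub ?_)).const_mul 2
    simp only [one_div]
    exact tendsto_inv_atTop_zero.comp ((tendsto_pow_atTop (by norm_num)).comp h1)
  refine (congrArg (Tendsto _ _) (congrArg 𝓝 ?_)).mp h2
  rw [sub_zero, show (4 : ℝ) = 2 ^ 2 by norm_num, Real.sqrt_sq (by norm_num)]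
  norm_num

theorem widthSeq_lt_four (j : ℕ) : widthSeq j < 4 :=
  (widthSeq_strictMono (Nat.lt_succ_self j)).trans_le
    (widthSeq_strictMono.monotone.ge_of_tendsto widthSeq_tendsto _)

theorem widthSeq_pos (j : ℕ) : 0 < widthSeq j := by
  refine lt_of_lt_of_le ?_ (widthSeq_strictMono.monotone (Nat.zero_le j))
  simp only [widthSeq]
  positivity

theorem bronze_eq (n : ℕ) :
    (bronze n : ℝ) * √13 = ((3 + √13) / 2) ^ n - ((3 - √13) / 2) ^ n := by
  have hs : √13 ^ 2 = 13 := Real.sq_sqrt (by norm_num)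
  induction n using Nat.strong_induction_on with
  | _ n ih =>
    match n with
    | 0 => simp [bronze]
    | 1 => simp [bronze]; ring
    | n + 2 =>
      have i1 := ih n (by omega)
      have i2 := ih (n + 1) (by omega)
      rw [bronze_add_two, pow_succ _ (n + 1), pow_succ _ (n + 1), pow_succ, pow_succ]
      rw [pow_succ, pow_succ] at i2
      push_cast
      linear_combination 3 * i2 + i1 -
        (((3 + √13) / 2) ^ n - ((3 - √13) / 2) ^ n) * hs / 4

/-! ### The chain of sides crossed on the way to a real number -/

namespace HexSide

/-- The action of the matrix of `HexSide.fwd` on a row `(q, s)` of denominators. -/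
def next : HexSide → ℕ × ℕ → ℕ × ℕ
  | s1, v => (v.1 + v.2, v.2)
  | s2, v => (v.1 + v.2, 3 * v.1 + 2 * v.2)
  | s3, v => (2 * v.1 + v.2, 3 * v.1 + 2 * v.2)
  | s4, v => (2 * v.1 + v.2, 3 * v.1 + v.2)
  | s5, v => (v.1, 3 * v.1 + v.2)

/-- The image of a side under `x ↦ 3 - x`. -/
def refl : HexSide → HexSide
  | s1 => s4
  | s2 => s3
  | s3 => s2
  | s4 => s1
  | s5 => s5

theorem fwd_refl {t : HexSide} {x : ℝ} (hx : 0 < x) (ht : t ≠ s5) :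
    t.refl.fwd x = 3 - t.fwd x := by
  cases t <;> simp only [fwd, refl] <;> first | exact absurd rfl ht | (field_simp; ring)

theorem next_refl (t : HexSide) : t.refl.next (0, 1) = t.next (0, 1) := by
  cases t <;> rfl

theorem fwd_lt_three {t : HexSide} {x : ℝ} (hx : 0 < x) (ht : t ≠ s5) : t.fwd x < 3 := by
  cases t
  · linarith [fwd_s1_lt hx]
  · linarith [fwd_s2_lt hx]
  · linarith [fwd_s3_lt hx]
  · exact fwd_s4_lt hx
  · exact absurd rfl ht

theorem next_fst_mono (t : HexSide) (v : ℕ × ℕ) : v.1 ≤ (t.next v).1 := by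
  cases t <;> simp only [next] <;> omega

theorem next_snd_mono (t : HexSide) (v : ℕ × ℕ) : v.2 ≤ (t.next v).2 := by
  cases t <;> simp only [next] <;> omega

theorem exists_fwd_eq {x : ℝ} (hx : 0 < x) (hirr : Irrational x) :
    ∃ t : HexSide, ∃ y : ℝ, 0 < y ∧ Irrational y ∧ x = t.fwd y := by
  have irr : ∀ (t : HexSide) (y : ℝ), x = t.fwd y → Irrational y := by
    rintro t y h ⟨z, rfl⟩
    apply hirr
    rw [h]
    cases t
    · exact ⟨z / (z + 1), by simp [fwd]⟩
    · exact ⟨(z + 3) / (z + 2), by simp [fwd]⟩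
    · exact ⟨(2 * z + 3) / (z + 2), by simp [fwd]⟩
    · exact ⟨(2 * z + 3) / (z + 1), by simp [fwd]⟩
    · exact ⟨z + 3, by simp [fwd]⟩
  have h1 : x ≠ 1 := fun h => hirr ⟨1, by simp [h]⟩
  have h2 : x ≠ 2 := fun h => hirr ⟨2, by simp [h]⟩
  have h3 : x ≠ 3 := fun h => hirr ⟨3, by simp [h]⟩
  have h4 : x ≠ 3 / 2 := fun h => hirr ⟨3 / 2, by simp [h]⟩
  suffices h : ∃ t : HexSide, ∃ y : ℝ, 0 < y ∧ x = t.fwd y by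
    obtain ⟨t, y, hy, e⟩ := h
    exact ⟨t, y, hy, irr t y e, e⟩
  rcases lt_or_gt_of_ne h1 with c1 | c1
  · refine ⟨s1, x / (1 - x), div_pos hx (by linarith), ?_⟩
    have : 1 - x ≠ 0 := by linarith
    simp only [fwd]
    rw [div_add_one this, div_div_div_cancel_right₀ this]
    ring
  rcases lt_or_gt_of_ne h4 with c2 | c2
  · have : x - 1 ≠ 0 := by linarith
    refine ⟨s2, (3 - 2 * x) / (x - 1), div_pos (by linarith) (by linarith), ?_⟩
    simp only [fwd]
    rw [div_add' _ _ _ this, div_add' _ _ _ this, div_div_div_cancel_right₀ this]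
    ring
  rcases lt_or_gt_of_ne h2 with c3 | c3
  · have : 2 - x ≠ 0 := by linarith
    refine ⟨s3, (2 * x - 3) / (2 - x), div_pos (by linarith) (by linarith), ?_⟩
    simp only [fwd]
    rw [mul_div_assoc', div_add' _ _ _ this, div_add' _ _ _ this, div_div_div_cancel_right₀ this]
    ring
  rcases lt_or_gt_of_ne h3 with c4 | c4
  · have : x - 2 ≠ 0 := by linarith
    refine ⟨s4, (3 - x) / (x - 2), div_pos (by linarith) (by linarith), ?_⟩
    simp only [fwd]
    rw [mul_div_assoc', div_add' _ _ _ this, div_add_one this, div_div_div_cancel_right₀ this]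
    ring
  · exact ⟨s5, x - 3, by linarith, by simp [fwd]⟩

end HexSide

/-- A side of the hexagonal tessellation with denominators `q`, `s` which separates `x` from `∞`;
`ξ` is the coordinate of `x` as seen from that side. -/
def CrossesSide (x ξ : ℝ) (v : ℕ × ℕ) : Prop :=
  0 < ξ ∧ ∃ p r : ℤ, 3 ∣ r ∧ (p * v.2 - v.1 * r = 1 ∨ p * v.2 - v.1 * r = -1) ∧
    x * (v.1 * ξ + v.2) = p * ξ + r

theorem CrossesSide.next {x ξ : ℝ} {v : ℕ × ℕ} {t : HexSide} (hξ : 0 < ξ)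
    (h : CrossesSide x (t.fwd ξ) v) : CrossesSide x ξ (t.next v) := by
  obtain ⟨q, s⟩ := v
  obtain ⟨-, p, r, hr, hdet, hx⟩ := h
  refine ⟨hξ, ?_⟩
  cases t <;> simp only [HexSide.next, fwd] at hx hdet ⊢
  · refine ⟨p + r, r, hr, ?_, ?_⟩
    · push_cast; convert hdet using 2 <;> ring
    · push_cast; field_simp at hx; linear_combination hx
  · refine ⟨p + r, 3 * p + 2 * r, by omega, ?_, ?_⟩
    · push_cast
      rcases hdet with h | h
      · right; linear_combination -h
      · left; linear_combination -h
    · push_cast; field_simp at hx; linear_combination hx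
  · refine ⟨2 * p + r, 3 * p + 2 * r, by omega, ?_, ?_⟩
    · push_cast; convert hdet using 2 <;> ring
    · push_cast; field_simp at hx; linear_combination hx
  · refine ⟨2 * p + r, 3 * p + r, by omega, ?_, ?_⟩
    · push_cast
      rcases hdet with h | h
      · right; linear_combination -h
      · left; linear_combination -h
    · push_cast; field_simp at hx; linear_combination hx
  · refine ⟨p, 3 * p + r, by omega, ?_, ?_⟩
    · push_cast; convert hdet using 2 <;> ring
    · push_cast; linear_combination hx

/-- This excludes the denominator 0 in second place, for which the descent of `exists_parent` would
stall. -/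
theorem CrossesSide.not_three_dvd {x ξ : ℝ} {v : ℕ × ℕ} (h : CrossesSide x ξ v) : ¬ 3 ∣ v.2 := by
  obtain ⟨-, p, r, ⟨r', rfl⟩, hdet, -⟩ := h
  rintro ⟨s', hs⟩
  rw [hs] at hdet
  push_cast at hdet
  have e : p * (3 * (s' : ℤ)) - v.1 * (3 * r') = 3 * (p * s' - v.1 * r') := by ring
  rw [e] at hdet
  omega

/-- The position of s/q relative to 1, 3/2, 2, 3 tells which of the five maps `HexSide.next`
produced (q, s), and inverting that map lowers q + s. -/
theorem CrossesSide.exists_parent {x ξ : ℝ} {v : ℕ × ℕ} (h : CrossesSide x ξ v) (hv : 1 ≤ v.1) :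
    ∃ (t : HexSide) (w : ℕ × ℕ), v = t.next w ∧ CrossesSide x (t.fwd ξ) w ∧
      w.1 + w.2 < v.1 + v.2 := by
  have h3 := h.not_three_dvd
  obtain ⟨q, s⟩ := v
  obtain ⟨hξ, p, r, hr, hdet, hx⟩ := h
  simp only at h3 hv hdet hx
  rcases Nat.lt_or_ge q s with c1 | c1
  swap
  · obtain ⟨u, rfl⟩ := Nat.exists_eq_add_of_le c1
    refine ⟨s1, (u, s), by simp [HexSide.next, add_comm], ⟨HexSide.fwd_pos _ hξ, p - r, r, hr, ?_, ?_⟩,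
      by simp only; omega⟩
    · push_cast at hdet ⊢; convert hdet using 2 <;> ring
    · push_cast at hx ⊢; simp only [fwd]; field_simp; linear_combination hx
  rcases Nat.lt_or_ge (3 * q) (2 * s) with c2 | c2
  swap
  · obtain ⟨u, w, rfl, rfl⟩ : ∃ u w, q = 2 * u + w ∧ s = 3 * u + w :=
      ⟨s - q, 3 * q - 2 * s, by omega, by omega⟩
    refine ⟨s4, (u, w), rfl, ⟨HexSide.fwd_pos _ hξ, r - p, 3 * p - 2 * r, by omega, ?_, ?_⟩,
      by simp only; omega⟩
    · push_cast at hdet ⊢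
      rcases hdet with h | h
      · right; linear_combination -h
      · left; linear_combination -h
    · push_cast at hx ⊢; simp only [fwd]; field_simp; linear_combination hx
  rcases Nat.lt_or_ge (2 * q) s with c3 | c3
  swap
  · obtain ⟨u, w, rfl, rfl⟩ : ∃ u w, q = 2 * u + w ∧ s = 3 * u + 2 * w :=
      ⟨2 * q - s, 2 * s - 3 * q, by omega, by omega⟩
    refine ⟨s3, (u, w), rfl, ⟨HexSide.fwd_pos _ hξ, 2 * p - r, 2 * r - 3 * p, by omega, ?_, ?_⟩,
      by simp only; omega⟩
    · push_cast at hdet ⊢; convert hdet using 2 <;> ring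
    · push_cast at hx ⊢; simp only [fwd]; field_simp; linear_combination hx
  rcases Nat.lt_or_ge (3 * q) s with c4 | c4
  swap
  · obtain ⟨u, w, rfl, rfl⟩ : ∃ u w, q = u + w ∧ s = 3 * u + 2 * w :=
      ⟨s - 2 * q, 3 * q - s, by omega, by omega⟩
    refine ⟨s2, (u, w), rfl, ⟨HexSide.fwd_pos _ hξ, r - 2 * p, 3 * p - r, by omega, ?_, ?_⟩,
      by simp only; omega⟩
    · push_cast at hdet ⊢
      rcases hdet with h | h
      · right; linear_combination -h
      · left; linear_combination -h
    · push_cast at hx ⊢; simp only [fwd]; field_simp; linear_combination hx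
  · obtain ⟨w, rfl⟩ := Nat.exists_eq_add_of_lt c4
    refine ⟨s5, (q, w + 1), by simp [HexSide.next, add_assoc],
      ⟨HexSide.fwd_pos _ hξ, p, r - 3 * p, by omega, ?_, ?_⟩, by simp only; omega⟩
    · push_cast at hdet ⊢; convert hdet using 2 <;> ring
    · push_cast at hx ⊢; simp only [fwd]; linear_combination hx

/-- The coordinates and denominators of the successive sides crossed on the way from `∞` to a
real number `ξ 0` between `0` and `3`. -/
structure IsSideChain (d : ℕ → HexSide) (ξ : ℕ → ℝ) (v : ℕ → ℕ × ℕ) : Prop where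
  zero_lt_three : ξ 0 < 3
  v_zero : v 0 = (0, 1)
  pos : ∀ n, 0 < ξ n
  fwd_eq : ∀ n, ξ n = (d n).fwd (ξ (n + 1))
  v_succ : ∀ n, v (n + 1) = (d n).next (v n)

theorem exists_isSideChain_of_fwd {d : ℕ → HexSide} {ξ : ℕ → ℝ} (h3 : ξ 0 < 3)
    (hpos : ∀ n, 0 < ξ n) (hf : ∀ n, ξ n = (d n).fwd (ξ (n + 1))) : ∃ v, IsSideChain d ξ v :=
  ⟨fun n => Nat.rec (0, 1) (fun k w => (d k).next w) n, h3, rfl, hpos, hf, fun _ => rfl⟩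

theorem exists_isSideChain {x : ℝ} (h0 : 0 < x) (h3 : x < 3) (hirr : Irrational x) :
    ∃ d ξ v, IsSideChain d ξ v ∧ ξ 0 = x := by
  classical
  let S := {y : ℝ // 0 < y ∧ Irrational y}
  have hS : ∀ y : S, ∃ (t : HexSide) (z : S), y.1 = t.fwd z.1 := fun y => by
    obtain ⟨t, z, hz, hz', e⟩ := exists_fwd_eq y.2.1 y.2.2
    exact ⟨t, ⟨z, hz, hz'⟩, e⟩
  choose T Z hTZ using hS
  let u : ℕ → S := fun n => Z^[n] ⟨x, h0, hirr⟩
  have hu : ∀ n, u (n + 1) = Z (u n) := fun n => Function.iterate_succ_apply' _ _ _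
  obtain ⟨v, hv⟩ := exists_isSideChain_of_fwd (d := fun n => T (u n)) (ξ := fun n => (u n).1) h3
    (fun n => (u n).2.1) (fun n => by rw [hu]; exact hTZ _)
  exact ⟨_, _, v, hv, rfl⟩

namespace IsSideChain

variable {d : ℕ → HexSide} {ξ : ℕ → ℝ} {v : ℕ → ℕ × ℕ}

theorem crossesSide (h : IsSideChain d ξ v) (k : ℤ) (n : ℕ) :
    CrossesSide (ξ 0 + 3 * k) (ξ n) (v n) := by
  induction n with
  | zero =>
    refine ⟨h.pos 0, 1, 3 * k, dvd_mul_right _ _, Or.inl ?_, ?_⟩ <;> simp [h.v_zero]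
  | succ n ih =>
    rw [h.fwd_eq n] at ih
    rw [h.v_succ]
    exact ih.next (h.pos _)

theorem side_zero_ne (h : IsSideChain d ξ v) : d 0 ≠ s5 := by
  intro hd
  have := h.zero_lt_three
  rw [h.fwd_eq 0, hd] at this
  linarith [lt_fwd_s5 (h.pos 1)]

theorem mono_fst (h : IsSideChain d ξ v) : Monotone fun n => (v n).1 :=
  monotone_nat_of_le_succ fun n => by rw [h.v_succ]; exact next_fst_mono _ _

theorem mono_snd (h : IsSideChain d ξ v) : Monotone fun n => (v n).2 :=
  monotone_nat_of_le_succ fun n => by rw [h.v_succ]; exact next_snd_mono _ _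

theorem one_le_snd (h : IsSideChain d ξ v) (n : ℕ) : 1 ≤ (v n).2 := by
  have := h.mono_snd (Nat.zero_le n)
  simpa [h.v_zero] using this

theorem one_le_fst (h : IsSideChain d ξ v) (n : ℕ) : 1 ≤ (v (n + 1)).1 := by
  refine le_trans ?_ (h.mono_fst (Nat.succ_le_succ (Nat.zero_le n)))
  have := h.side_zero_ne
  simp only [Nat.succ_eq_add_one, h.v_succ, h.v_zero]
  cases hd : d 0 <;> simp_all [HexSide.next]

/-- The index is shifted by one because the initial side (0, ∞) has q = 0, so that s/q would be
infinite there. -/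
theorem isOrbit (h : IsSideChain d ξ v) :
    IsOrbit (fun n => d (n + 1)) (fun n => ξ (n + 1))
      (fun n => ((v (n + 1)).2 : ℝ) / (v (n + 1)).1) where
  fwd_pos n := h.pos _
  bwd_pos n := by
    have h1 : (0 : ℝ) < (v (n + 1)).1 := by exact_mod_cast h.one_le_fst n
    have h2 : (0 : ℝ) < (v (n + 1)).2 := by exact_mod_cast h.one_le_snd (n + 1)
    positivity
  fwd_eq n := h.fwd_eq _
  bwd_eq n := by
    have h1 : (0 : ℝ) < (v (n + 1)).1 := by exact_mod_cast h.one_le_fst n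
    have h2 : (0 : ℝ) < (v (n + 1)).2 := by exact_mod_cast h.one_le_snd (n + 1)
    rw [h.v_succ (n + 1)]
    cases d (n + 1) <;> simp only [HexSide.next, HexSide.rev, fwd] <;> push_cast <;> field_simp <;> ring

/-- A bounded monotone sequence of denominators is eventually constant, and only s5 leaves the first
one unchanged. But each s5 lowers ξ by 3, and ξ stays positive. For the second denominator the same
argument applies with s1 and 1/ξ. -/
theorem tendsto_fst (h : IsSideChain d ξ v) : Tendsto (fun n => (v n).1) atTop atTop := by
  refine tendsto_atTop_atTop_of_monotone h.mono_fst fun B => ?_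
  by_contra hB
  push Not at hB
  obtain ⟨N, hN⟩ := converges_of_monotone_of_bounded h.mono_fst (fun n => (hB n).le)
  obtain ⟨b, N, hN⟩ : ∃ b N, ∀ n ≥ N, (v n).1 = b := ⟨N, hN⟩
  have hd : ∀ n ≥ N, ξ (n + 1) = ξ n - 3 := by
    intro n hn
    have e1 := hN n hn
    have e2 := hN (n + 1) (by omega)
    rw [h.v_succ] at e2
    have e3 := h.one_le_snd n
    have e4 := h.fwd_eq n
    cases hd : d n <;> rw [hd] at e2 e4 <;> simp only [HexSide.next] at e2 <;>
      first | omega | (simp only [fwd] at e4; linarith)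
  have hk : ∀ k : ℕ, ξ (N + k) = ξ N - 3 * k := by
    intro k
    induction k with
    | zero => simp
    | succ k ih => rw [← add_assoc, hd _ (by omega), ih]; push_cast; ring
  obtain ⟨k, hk'⟩ := exists_nat_gt (ξ N)
  have := h.pos (N + k)
  have h0 := h.pos N
  rw [hk] at this
  linarith

theorem tendsto_snd (h : IsSideChain d ξ v) : Tendsto (fun n => (v n).2) atTop atTop := by
  refine tendsto_atTop_atTop_of_monotone h.mono_snd fun B => ?_
  by_contra hB
  push Not at hB
  obtain ⟨N, hN⟩ := converges_of_monotone_of_bounded h.mono_snd (fun n => (hB n).le)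
  obtain ⟨b, N, hN⟩ : ∃ b N, ∀ n ≥ N, (v n).2 = b := ⟨N, hN⟩
  have hd : ∀ n ≥ N, 1 / ξ (n + 2) = 1 / ξ (n + 1) - 1 := by
    intro n hn
    have e1 := hN (n + 1) (by omega)
    have e2 := hN (n + 1 + 1) (by omega)
    rw [h.v_succ] at e2
    have e3 := h.one_le_snd (n + 1)
    have e5 := h.one_le_fst n
    have e4 := h.fwd_eq (n + 1)
    have e6 := h.pos (n + 1 + 1)
    cases hd : d (n + 1) <;> rw [hd] at e2 e4 <;> simp only [HexSide.next] at e2 <;>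
      first | omega | skip
    simp only [fwd] at e4
    rw [e4]
    field_simp
    ring
  have hk : ∀ k : ℕ, 1 / ξ (N + 1 + k) = 1 / ξ (N + 1) - k := by
    intro k
    induction k with
    | zero => simp
    | succ k ih =>
      rw [show N + 1 + (k + 1) = N + k + 2 by ring, hd _ (by omega),
        show N + k + 1 = N + 1 + k by ring, ih]
      push_cast; ring
  obtain ⟨k, hk'⟩ := exists_nat_gt (1 / ξ (N + 1))
  have := one_div_pos.mpr (h.pos (N + 1 + k))
  rw [hk] at this
  linarith

/-- Descent along parents ends at a vertical side, and the side maps are injective, so the way back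
follows the chain. -/
theorem exists_eq_of_crossesSide (h : IsSideChain d ξ v) {k : ℤ} {y : ℝ} {w : ℕ × ℕ}
    (hy : CrossesSide (ξ 0 + 3 * k) y w) (hw : 1 ≤ w.1) : ∃ n, ξ n = y ∧ v n = w := by
  induction hN : w.1 + w.2 using Nat.strong_induction_on generalizing y w with
  | _ N ih =>
    subst hN
    obtain ⟨t, w', rfl, hc, hlt⟩ := hy.exists_parent hw
    have hypos := hy.1
    suffices hs : ∃ n, ∃ t', ξ n = HexSide.fwd t' y ∧ t'.next (v n) = t.next w' by
      obtain ⟨n, t', e1, e2⟩ := hs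
      obtain ⟨e3, e4⟩ := fwd_injective (h.pos (n + 1)) hypos ((h.fwd_eq n).symm.trans e1)
      exact ⟨n + 1, e4, by rw [h.v_succ, e3, e2]⟩
    rcases Nat.eq_zero_or_pos w'.1 with h0 | h0
    · obtain ⟨q, s⟩ := w'
      simp only at h0
      subst h0
      obtain ⟨hz, p, r, ⟨r', rfl⟩, hdet, hx⟩ := hc
      simp only [Nat.cast_zero, zero_mul, sub_zero, zero_add] at hdet hx
      have hs : s = 1 := by
        have : (s : ℤ) ∣ 1 := by
          rcases hdet with e | e
          · exact ⟨p, by linarith⟩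
          · exact ⟨-p, by linarith⟩
        exact_mod_cast Int.eq_one_of_dvd_one (by positivity) this
      subst hs
      have ht5 : t ≠ s5 := by rintro rfl; simp [HexSide.next] at hw
      have hz3 := fwd_lt_three hypos ht5
      have h00 := h.pos 0
      have h03 := h.zero_lt_three
      rcases hdet with e | e
      · have hp : p = 1 := by simpa using e
        subst hp
        push_cast at hx
        have e1 : (k : ℝ) - r' < 1 := by linarith
        have e2 : -1 < (k : ℝ) - r' := by linarith
        have e3 : k = r' := by
          have e1' : k - r' < 1 := by exact_mod_cast e1
          have e2' : -1 < k - r' := by exact_mod_cast e2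
          omega
        subst e3
        exact ⟨0, t, by linarith, by rw [h.v_zero]⟩
      -- The parent is the vertical side at 3k + 3 instead of 3k, with reversed orientation. The
      -- reflection x ↦ 3 - x exchanges them inside the same hexagon and changes no denominators.
      · have hp : p = -1 := by simpa using e
        subst hp
        push_cast at hx
        have e1 : (r' : ℝ) - k < 2 := by linarith
        have e2 : 0 < (r' : ℝ) - k := by linarith
        have e3 : r' = k + 1 := by
          have e1' : r' - k < 2 := by exact_mod_cast e1
          have e2' : 0 < r' - k := by exact_mod_cast e2
          omega
        subst e3
        push_cast at hx
        exact ⟨0, t.refl, by rw [fwd_refl hypos ht5]; linarith, by rw [h.v_zero, next_refl]⟩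
    · obtain ⟨n, e1, e2⟩ := ih _ hlt hc h0 rfl
      exact ⟨n, t, e1, by rw [e2]⟩

end IsSideChain

/-! ### Distances to fractions as widths -/

/-- The normalized distance from `x` to the fraction `p / q`. -/
noncomputable def cuspDist (x : ℝ) (p : ℤ) (q : ℕ) : ℝ :=
  if 3 ∣ p then q * |q * x - p| / √3 else √3 * (q * |q * x - p|)

/-- From x = (pξ + r)/(qξ + s) and determinant ±1 one gets |qx - p| = 1/(qξ + s) and |sx - r| =
ξ/(qξ + s). -/
theorem CrossesSide.exists_cuspDist {x ξ : ℝ} {v : ℕ × ℕ} (h : CrossesSide x ξ v) (h1 : 1 ≤ v.1)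
    (h2 : 1 ≤ v.2) :
    (∃ p : ℤ, IsCoprime p v.1 ∧ cuspDist x p v.1 = √3 / (ξ + v.2 / v.1)) ∧
    ∃ r : ℤ, IsCoprime r v.2 ∧ cuspDist x r v.2 = √3 / (3 / ξ + 3 / (v.2 / v.1)) := by
  obtain ⟨q, s⟩ := v
  obtain ⟨hξ, p, r, hr, hdet, hx⟩ := h
  simp only at *
  have hs0 : 0 < √3 := by positivity
  have hs : √3 ^ 2 = 3 := Real.sq_sqrt (by norm_num)
  have hq : (0 : ℝ) < q := by exact_mod_cast h1
  have hs' : (0 : ℝ) < s := by exact_mod_cast h2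
  have hD : 0 < q * ξ + s := by positivity
  have habs : |((p * s - q * r : ℤ) : ℝ)| = 1 := by
    rcases hdet with e | e <;> rw [e] <;> simp
  have e1 : q * x - p = -((p * s - q * r : ℤ) : ℝ) / (q * ξ + s) := by
    rw [eq_div_iff hD.ne']; push_cast; linear_combination q * hx
  have e2 : s * x - r = ((p * s - q * r : ℤ) : ℝ) * (ξ / (q * ξ + s)) := by
    rw [mul_div_assoc', eq_div_iff hD.ne']; push_cast; linear_combination s * hx
  have hp3 : ¬ 3 ∣ p := by
    rintro ⟨p', rfl⟩
    obtain ⟨r', rfl⟩ := hr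
    have e : 3 * p' * (s : ℤ) - q * (3 * r') = 3 * (p' * s - q * r') := by ring
    rw [e] at hdet
    omega
  refine ⟨⟨p, ?_, ?_⟩, r, ?_, ?_⟩
  · rcases hdet with e | e
    · exact ⟨s, -r, by linarith⟩
    · exact ⟨-s, r, by linarith⟩
  · rw [cuspDist, if_neg hp3, e1, abs_div, abs_neg, habs, abs_of_pos hD]
    field_simp
  · rcases hdet with e | e
    · exact ⟨-q, p, by linarith⟩
    · exact ⟨q, -p, by linarith⟩
  · rw [cuspDist, if_pos hr, e2, abs_mul, habs, abs_of_pos (div_pos hξ hD)]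
    field_simp
    rw [hs]
    ring

theorem exists_unit_sign {a : ℝ} (ha : a ≠ 0) : ∃ σ : ℤ, (σ = 1 ∨ σ = -1) ∧ a = σ * |a| := by
  rcases lt_or_gt_of_ne ha with h | h
  · exact ⟨-1, Or.inr rfl, by rw [abs_of_neg h]; simp⟩
  · exact ⟨1, Or.inl rfl, by rw [abs_of_pos h]; simp⟩

/-- The hypothesis says that the width W = 1/(q|qx - p|) exceeds 3. The sides at p/q have second
denominators s in one residue class modulo 3q, so s/q < 3 can be arranged, and then ξ = W - s/q is
positive. -/
theorem exists_crossesSide_of_not_dvd {x : ℝ} {p : ℤ} {q : ℕ} (hx : (q : ℝ) * x - p ≠ 0)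
    (hq : 1 ≤ q) (hpq : IsCoprime p q) (h3 : ¬ 3 ∣ p) (hlt : cuspDist x p q < 1 / √3) :
    ∃ ξ s, CrossesSide x ξ (q, s) ∧ cuspDist x p q = √3 / (ξ + s / q) := by
  have hs0 : 0 < √3 := by positivity
  have hs : √3 ^ 2 = 3 := Real.sq_sqrt (by norm_num)
  have hq0 : (0 : ℝ) < q := by exact_mod_cast hq
  have ha : 0 < |q * x - p| := abs_pos.mpr hx
  rw [cuspDist, if_neg h3] at hlt ⊢
  rw [lt_div_iff₀ hs0] at hlt
  have hW : 3 < 1 / (q * |q * x - p|) := by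
    rw [lt_div_iff₀ (by positivity)]; nlinarith
  obtain ⟨σ, hσ, hσx⟩ := exists_unit_sign hx
  have hcop : IsCoprime p (3 * q : ℤ) := by
    refine IsCoprime.mul_right ?_ hpq
    exact ((Int.prime_three.coprime_iff_not_dvd).mpr h3).symm
  obtain ⟨a, b, hab⟩ := hcop
  have hq3 : (0 : ℤ) < 3 * q := by omega
  have hm1 := Int.emod_nonneg (-σ * a) hq3.ne'
  have hm2 := Int.emod_lt_of_pos (-σ * a) hq3
  have hm3 := Int.emod_add_mul_ediv (-σ * a) (3 * q)
  obtain ⟨s, hs'⟩ := Int.eq_ofNat_of_zero_le hm1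
  rw [hs'] at hm2 hm3
  set k := -σ * a / (3 * q) with hk
  have hsq : (s : ℝ) / q < 3 := by
    rw [div_lt_iff₀ hq0]; exact_mod_cast hm2
  -- The sign σ of qx - p is built into the determinant so that x lies on the side where ξ > 0.
  have hdet : p * (s : ℤ) - q * (3 * (σ * b - p * k)) = -σ := by
    linear_combination p * hm3 - σ * hab
  refine ⟨1 / (q * |q * x - p|) - s / q, s, ⟨by linarith, p, 3 * (σ * b - p * k), dvd_mul_right _ _,
    ?_, ?_⟩, ?_⟩
  · simp only [hdet]
    rcases hσ with rfl | rfl <;> simp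
  · have hdet' : (p : ℝ) * s - q * (3 * (σ * b - p * k)) = -σ := by exact_mod_cast hdet
    push_cast
    generalize |(q : ℝ) * x - p| = A at ha hσx
    have h1 : q * (1 / (q * A)) * A = 1 := by field_simp
    have h2 : q * ((s : ℝ) / q) = s := by field_simp
    generalize 1 / (q * A) = W at h1
    generalize (s : ℝ) / q = η at h2
    have : (x * (q * (W - η) + s) - (p * (W - η) + 3 * (σ * b - p * k))) * q = 0 := by
      linear_combination q * W * hσx + σ * h1 + (p - x * q) * h2 + hdet'
    have h0 := (mul_eq_zero.mp this).resolve_right hq0.ne'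
    linear_combination h0
  · rw [sub_add_cancel]
    field_simp

/-- As before, but the other denominator is free modulo s, and the width 1/(s|sx - r|) exceeds 1. -/
theorem exists_crossesSide_of_dvd {x : ℝ} {r : ℤ} {s : ℕ} (hx : (s : ℝ) * x - r ≠ 0)
    (hs1 : 1 ≤ s) (hrs : IsCoprime r s) (h3 : 3 ∣ r) (hlt : cuspDist x r s < 1 / √3) :
    ∃ ξ q, 1 ≤ q ∧ CrossesSide x ξ (q, s) ∧ cuspDist x r s = √3 / (3 / ξ + 3 / (s / q)) := by
  have hs0 : 0 < √3 := by positivity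
  have hs : √3 ^ 2 = 3 := Real.sq_sqrt (by norm_num)
  have hs' : (0 : ℝ) < s := by exact_mod_cast hs1
  have ha : 0 < |s * x - r| := abs_pos.mpr hx
  rw [cuspDist, if_pos h3] at hlt ⊢
  rw [div_lt_div_iff_of_pos_right hs0] at hlt
  have hW : 1 < 1 / (s * |s * x - r|) := by
    rw [lt_div_iff₀ (by positivity)]; linarith
  obtain ⟨σ, hσ, hσx⟩ := exists_unit_sign hx
  obtain ⟨a, b, hab⟩ := hrs
  have hsz : (0 : ℤ) < s := by omega
  -- The shift by one selects a representative q + 1 between 1 and s instead of between 0 and s - 1,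
  -- since the denominator must be positive.
  have hm1 := Int.emod_nonneg (-σ * a - 1) hsz.ne'
  have hm2 := Int.emod_lt_of_pos (-σ * a - 1) hsz
  have hm3 := Int.emod_add_mul_ediv (-σ * a - 1) s
  obtain ⟨q, hq'⟩ := Int.eq_ofNat_of_zero_le hm1
  rw [hq'] at hm2 hm3
  set k := (-σ * a - 1) / (s : ℤ) with hk
  have hqs : ((q + 1 : ℕ) : ℝ) / s ≤ 1 := by
    rw [div_le_one hs']; exact_mod_cast hm2
  have hdet : (σ * b - r * k) * (s : ℤ) - ((q + 1 : ℕ) : ℤ) * r = σ := by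
    push_cast
    linear_combination -r * hm3 + σ * hab
  have hW' : 0 < 1 / (s * |s * x - r|) - ((q + 1 : ℕ) : ℝ) / s := by linarith
  refine ⟨1 / (1 / (s * |s * x - r|) - ((q + 1 : ℕ) : ℝ) / s), q + 1, by omega,
    ⟨by positivity, σ * b - r * k, r, h3, ?_, ?_⟩, ?_⟩
  · simp only [hdet]
    exact hσ
  · have hdet' : ((σ : ℝ) * b - r * k) * (s : ℝ) - ((q + 1 : ℕ) : ℝ) * r = σ := by
      exact_mod_cast hdet
    generalize hz : 1 / (s * |s * x - r|) - ((q + 1 : ℕ) : ℝ) / s = z at hW'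
    have hz' : s * z + ((q + 1 : ℕ) : ℝ) = 1 / |s * x - r| := by
      rw [← hz]; field_simp; ring
    rw [eq_div_iff ha.ne'] at hz'
    push_cast at hdet' hz' ⊢
    generalize |(s : ℝ) * x - r| = A at ha hσx hz'
    field_simp
    have : (x * (q + 1 + s * z) - (σ * b - r * k + r * z)) * s = 0 := by
      linear_combination (s * z + (q + 1)) * hσx + σ * hz' - hdet'
    have h0 := (mul_eq_zero.mp this).resolve_right hs'.ne'
    linear_combination h0
  · have hq1 : ((q + 1 : ℕ) : ℝ) ≠ 0 := by positivity
    have e : 3 / (1 / (1 / (s * |s * x - r|) - ((q + 1 : ℕ) : ℝ) / s)) +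
        3 / (s / ((q + 1 : ℕ) : ℝ)) = 3 / (s * |s * x - r|) := by
      rw [div_div_eq_mul_div, div_div_eq_mul_div]
      ring
    rw [e, div_div_eq_mul_div, eq_div_iff (by norm_num)]
    field_simp
    linear_combination -hs

namespace IsSideChain

variable {d : ℕ → HexSide} {ξ : ℕ → ℝ} {v : ℕ → ℕ × ℕ}

theorem eventually_sideWidth_lt (h : IsSideChain d ξ v) {k : ℤ} {c : ℝ} (hc : 0 < c) {Q : ℕ}
    (hQ : ∀ (p : ℤ) (q : ℕ), IsCoprime p q → Q ≤ q → c < cuspDist (ξ 0 + 3 * k) p q) :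
    ∀ᶠ n in atTop, sideWidth (ξ (n + 1)) (((v (n + 1)).2 : ℝ) / (v (n + 1)).1) < √3 / c := by
  have hs0 : 0 < √3 := by positivity
  have h1 := (tendsto_add_atTop_iff_nat 1).mpr h.tendsto_fst
  have h2 := (tendsto_add_atTop_iff_nat 1).mpr h.tendsto_snd
  filter_upwards [h1.eventually_ge_atTop Q, h2.eventually_ge_atTop Q] with n hn1 hn2
  have hξ := h.isOrbit.fwd_pos n
  have hη := h.isOrbit.bwd_pos n
  obtain ⟨⟨p, hp, ep⟩, r, hr, er⟩ := (h.crossesSide k (n + 1)).exists_cuspDist (h.one_le_fst n)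
    (h.one_le_snd _)
  have a1 := hQ p _ hp hn1
  have a2 := hQ r _ hr hn2
  rw [ep, lt_div_iff₀ (by positivity)] at a1
  rw [er, lt_div_iff₀ (by positivity)] at a2
  rw [sideWidth, max_lt_iff, lt_div_iff₀ hc, lt_div_iff₀ hc]
  constructor <;> linarith

theorem exists_lt_cuspDist (h : IsSideChain d ξ v) (hirr : Irrational (ξ 0)) {k : ℤ} {c : ℝ}
    (hc : 0 < c) (hc' : c < 1 / √3)
    (hw : ∀ᶠ n in atTop,
      sideWidth (ξ (n + 1)) (((v (n + 1)).2 : ℝ) / (v (n + 1)).1) < √3 / c) :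
    ∃ Q : ℕ, ∀ (p : ℤ) (q : ℕ), IsCoprime p q → Q ≤ q → c < cuspDist (ξ 0 + 3 * k) p q := by
  obtain ⟨N, hN⟩ := eventually_atTop.mp hw
  have hs0 : 0 < √3 := by positivity
  -- Denominators grow along the chain, so a side with a denominator this large occurs after index N
  -- + 1.
  refine ⟨max ((v (N + 1)).1 + 1) ((v (N + 1)).2 + 1), fun p q hpq hq => ?_⟩
  obtain ⟨hq1, hq2⟩ := max_le_iff.mp hq
  by_contra hcon
  push Not at hcon
  have hq0 : 1 ≤ q := by omega
  have hx : (q : ℝ) * (ξ 0 + 3 * k) - p ≠ 0 := by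
    intro h0
    apply hirr
    refine ⟨(p : ℚ) / q - 3 * k, ?_⟩
    have : (q : ℝ) ≠ 0 := by positivity
    push_cast
    field_simp
    linarith
  have big : ∀ n, N + 1 < n → sideWidth (ξ n) (((v n).2 : ℝ) / (v n).1) < √3 / c := by
    intro n hn
    have := hN (n - 1) (by omega)
    rwa [show n - 1 + 1 = n by omega] at this
  by_cases h3 : 3 ∣ p
  · obtain ⟨y, w, hw1, hcr, e⟩ := exists_crossesSide_of_dvd hx hq0 hpq h3 (by linarith)
    obtain ⟨n, rfl, hv⟩ := h.exists_eq_of_crossesSide hcr hw1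
    have hn : N + 1 < n := by
      by_contra hn
      have := h.mono_snd (not_lt.mp hn)
      simp only [hv] at this
      omega
    have hb := big n hn
    have hξ := h.pos n
    rw [hv] at hb
    have hb' := (max_lt_iff.mp hb).2
    have hw0 : (0 : ℝ) < w := by exact_mod_cast hw1
    have hq0' : (0 : ℝ) < q := by exact_mod_cast hq0
    rw [e, div_le_iff₀ (by positivity)] at hcon
    rw [lt_div_iff₀ hc] at hb'
    simp only at hb'
    linarith
  · obtain ⟨y, w, hcr, e⟩ := exists_crossesSide_of_not_dvd hx hq0 hpq h3 (by linarith)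
    obtain ⟨n, rfl, hv⟩ := h.exists_eq_of_crossesSide hcr hq0
    have hn : N + 1 < n := by
      by_contra hn
      have := h.mono_fst (not_lt.mp hn)
      simp only [hv] at this
      omega
    have hb := big n hn
    have hξ := h.pos n
    rw [hv] at hb
    have hb' := (max_lt_iff.mp hb).1
    have hq0' : (0 : ℝ) < q := by exact_mod_cast hq0
    rw [e, div_le_iff₀ (by positivity)] at hcon
    rw [lt_div_iff₀ hc] at hb'
    simp only at hb'
    linarith

end IsSideChain

/-! ### The parametrization of the circle and the height -/

/-- The norm of `x + 1 + ω`. -/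
noncomputable def eisNorm (x : ℝ) : ℝ := x ^ 2 + 3 * x + 3

theorem three_quarters_le_eisNorm (x : ℝ) : 3 / 4 ≤ eisNorm x := by
  unfold eisNorm; nlinarith [sq_nonneg (x + 3 / 2)]

theorem eisNorm_pos (x : ℝ) : 0 < eisNorm x := by linarith [three_quarters_le_eisNorm x]

theorem continuous_eisNorm : Continuous eisNorm := by unfold eisNorm; fun_prop

theorem ofReal_eisNorm (x : ℝ) : ((eisNorm x : ℝ) : ℂ) = (x : ℂ) ^ 2 + 3 * x + 3 := by
  simp [eisNorm]

/-- The rational parametrization `(x + 1 + ω) / (x + 1 + ω̄)` of the unit circle without `1`. -/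
noncomputable def circlePt (x : ℝ) : ℂ := (x + 1 + eisOmega) ^ 2 / eisNorm x

theorem circlePt_re (x : ℝ) : (circlePt x).re = 1 - 3 / 2 / eisNorm x := by
  have hs : √3 ^ 2 = 3 := Real.sq_sqrt (by norm_num)
  have h := eisNorm_pos x
  have h' : eisNorm x = x ^ 2 + 3 * x + 3 := rfl
  rw [circlePt, Complex.div_ofReal_re, eq_sub_iff_add_eq, ← add_div, div_eq_one_iff_eq h.ne', h']
  simp [eisOmega, pow_two]
  linear_combination -hs / 4

theorem circlePt_im (x : ℝ) : (circlePt x).im = √3 * (x + 3 / 2) / eisNorm x := by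
  rw [circlePt, Complex.div_ofReal_im]
  simp [eisOmega, pow_two]
  ring

theorem norm_circlePt (x : ℝ) : ‖circlePt x‖ = 1 := by
  have hs : √3 ^ 2 = 3 := Real.sq_sqrt (by norm_num)
  have h := eisNorm_pos x
  have h' : eisNorm x = x ^ 2 + 3 * x + 3 := rfl
  have : ‖circlePt x‖ ^ 2 = 1 := by
    rw [Complex.sq_norm, Complex.normSq_apply, circlePt_re, circlePt_im]
    field_simp
    rw [h']
    linear_combination 4 * (x + 3 / 2) ^ 2 * hs
  nlinarith [norm_nonneg (circlePt x)]

/-- The inverse of `circlePt`. -/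
noncomputable def circleCoord (z : ℂ) : ℝ := √3 / 2 * (z.im / (1 - z.re)) - 3 / 2

theorem circleCoord_circlePt (x : ℝ) : circleCoord (circlePt x) = x := by
  have hs : √3 ^ 2 = 3 := Real.sq_sqrt (by norm_num)
  have h := eisNorm_pos x
  rw [circleCoord, circlePt_re, circlePt_im]
  field_simp
  linear_combination (2 * x + 3) * hs

theorem circlePt_circleCoord {z : ℂ} (hz : ‖z‖ = 1) (h1 : z ≠ 1) : circlePt (circleCoord z) = z := by
  have hs : √3 ^ 2 = 3 := Real.sq_sqrt (by norm_num)
  have hn : z.re ^ 2 + z.im ^ 2 = 1 := by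
    have := Complex.sq_norm z
    rw [hz, Complex.normSq_apply] at this
    linarith
  have hre : 1 - z.re ≠ 0 := by
    intro h
    have h2 : z.re = 1 := by linarith
    have h3 : z.im = 0 := by rw [h2] at hn; nlinarith
    exact h1 (Complex.ext (by simp [h2]) (by simp [h3]))
  have hN : eisNorm (circleCoord z) = 3 / 2 / (1 - z.re) := by
    rw [eisNorm, circleCoord]
    field_simp
    linear_combination z.im ^ 2 * hs + 3 * hn
  apply Complex.ext
  · rw [circlePt_re, hN]
    field_simp
    ring
  · rw [circlePt_im, hN, circleCoord]
    field_simp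
    linear_combination z.im * hs

theorem continuousAt_circleCoord (x : ℝ) : ContinuousAt circleCoord (circlePt x) := by
  have h : 1 - (circlePt x).re ≠ 0 := by
    rw [circlePt_re]
    have := eisNorm_pos x
    have h2 : 0 < 3 / 2 / eisNorm x := by positivity
    linarith
  unfold circleCoord
  exact ((Complex.continuous_im.continuousAt.div
    (continuousAt_const.sub Complex.continuous_re.continuousAt) h).const_mul _).sub continuousAt_const

theorem dist_circlePt (x y : ℝ) :
    dist (circlePt x) (circlePt y) = √3 * |x - y| / (√(eisNorm x) * √(eisNorm y)) := by
  have hs : √3 ^ 2 = 3 := Real.sq_sqrt (by norm_num)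
  have hx := eisNorm_pos x
  have hy := eisNorm_pos y
  have hx' : eisNorm x = x ^ 2 + 3 * x + 3 := rfl
  have hy' : eisNorm y = y ^ 2 + 3 * y + 3 := rfl
  rw [← Real.sqrt_mul hx.le, ← sq_eq_sq₀ dist_nonneg (by positivity), div_pow, mul_pow, hs,
    Real.sq_sqrt (by positivity), sq_abs, dist_eq_norm, Complex.sq_norm, Complex.normSq_apply,
    Complex.sub_re, Complex.sub_im, circlePt_re, circlePt_re, circlePt_im, circlePt_im]
  have e : ∀ a b : ℝ, (√3 * a - √3 * b) * (√3 * a - √3 * b) = 3 * (a - b) ^ 2 := by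
    intro a b; linear_combination (a - b) ^ 2 * hs
  rw [mul_div_assoc, mul_div_assoc, e]
  field_simp
  rw [hx', hy']
  ring

theorem eisOmega_mem : eisOmega ∈ eisField := by
  have h : ((√3 : ℝ) : ℂ) * Complex.I ∈ eisField := IntermediateField.subset_adjoin ℚ _ rfl
  have h2 : (2 : ℂ) ∈ eisField := by exact_mod_cast eisField.natCast_mem 2
  exact eisField.div_mem (eisField.add_mem eisField.one_mem h) h2

theorem circlePt_rat_mem (u : ℚ) : circlePt u ∈ eisPoints := by
  refine ⟨norm_circlePt _, ?_⟩
  have hu : (u : ℂ) ∈ eisField := eisField.algebraMap_mem u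
  have h3 : (3 : ℂ) ∈ eisField := by exact_mod_cast eisField.natCast_mem 3
  rw [circlePt, ofReal_eisNorm]
  push_cast
  exact eisField.div_mem
    (eisField.pow_mem (eisField.add_mem (eisField.add_mem hu eisField.one_mem) eisOmega_mem) 2)
    (eisField.add_mem (eisField.add_mem (eisField.pow_mem hu 2) (eisField.mul_mem h3 hu)) h3)

theorem exists_rat_circleCoord {z : ℂ} (hz : z ∈ eisField) : ∃ u : ℚ, circleCoord z = u := by
  obtain ⟨a, b, c, hc, -, rfl⟩ := exists_eisRep hz
  have hs : √3 ^ 2 = 3 := Real.sq_sqrt (by norm_num)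
  refine ⟨3 / 4 * ((b / c) / (1 - (a + b / 2) / c)) - 3 / 2, ?_⟩
  have e : ((a : ℂ) + b * eisOmega) / c = ((a : ℂ) + b * eisOmega) / ((c : ℝ) : ℂ) := by simp
  have hre : (((a : ℂ) + b * eisOmega) / c).re = (a + b / 2) / c := by
    rw [e, Complex.div_ofReal_re]
    simp [eisOmega]
    ring
  have him : (((a : ℂ) + b * eisOmega) / c).im = √3 / 2 * (b / c) := by
    rw [e, Complex.div_ofReal_im]
    simp [eisOmega]
    ring
  rw [circleCoord, hre, him]
  push_cast
  linear_combination ((b : ℝ) / c / (1 - (a + b / 2) / c)) / 4 * hs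

theorem circlePt_mem_iff (x : ℝ) : circlePt x ∈ eisPoints ↔ ¬ Irrational x := by
  rw [Irrational, not_not]
  constructor
  · rintro ⟨-, h⟩
    obtain ⟨u, hu⟩ := exists_rat_circleCoord h
    rw [circleCoord_circlePt] at hu
    exact ⟨u, hu.symm⟩
  · rintro ⟨u, rfl⟩
    exact circlePt_rat_mem u

theorem eisHeight_one : eisHeight 1 = 1 := by
  have := eisHeight_eq (a := 1) (b := 0) (c := 1) one_pos (by decide)
  simpa using this

theorem gcd_gcd_eq_one {a b c u w z : ℤ} (h : u * a + w * b + z * c = 1) :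
    Int.gcd (Int.gcd a b) c = 1 := by
  have h1 : (Int.gcd (Int.gcd a b) c : ℤ) ∣ 1 := by
    rw [← h]
    have d1 : (Int.gcd (Int.gcd a b) c : ℤ) ∣ Int.gcd a b := Int.gcd_dvd_left _ _
    exact dvd_add (dvd_add ((d1.trans (Int.gcd_dvd_left _ _)).mul_left _)
      ((d1.trans (Int.gcd_dvd_right _ _)).mul_left _)) ((Int.gcd_dvd_right _ _).mul_left _)
  exact_mod_cast Int.eq_one_of_dvd_one (by positivity) h1

theorem eisHeight_eq_of_eq {y : ℂ} {a b c u w z : ℤ} (hc : 0 < c)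
    (h : u * a + w * b + z * c = 1) (hy : y = ((a : ℂ) + b * eisOmega) / c) :
    (eisHeight y : ℤ) = c := by
  obtain ⟨n, rfl⟩ := Int.eq_ofNat_of_zero_le hc.le
  have h1 := eisHeight_eq (a := a) (b := b) (c := n) (by exact_mod_cast hc) (gcd_gcd_eq_one h)
  rw [hy]
  exact_mod_cast h1

/-- The fraction (p + q + qω)² / (p² + 3pq + 3q²) is reduced when 3 ∤ p, and otherwise exactly a
factor 3 cancels: 1 + ω has norm 3, and 3 ramifies. -/
theorem eisHeight_circlePt {p : ℤ} {q : ℕ} (hq : 1 ≤ q) (hpq : IsCoprime p q) :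
    (eisHeight (circlePt (p / q)) : ℝ) =
      if 3 ∣ p then q ^ 2 * eisNorm (p / q) / 3 else q ^ 2 * eisNorm (p / q) := by
  have hq0 : (q : ℝ) ≠ 0 := by positivity
  have hqC : (q : ℂ) ≠ 0 := by exact_mod_cast hq0
  have hN := eisNorm_pos (p / q)
  have hNC : ((eisNorm (p / q) : ℝ) : ℂ) ≠ 0 := by exact_mod_cast hN.ne'
  have hN' : (q : ℝ) ^ 2 * eisNorm (p / q) = p ^ 2 + 3 * p * q + 3 * q ^ 2 := by
    rw [eisNorm]; field_simp
  have hNC' : (q : ℂ) ^ 2 * ((eisNorm (p / q) : ℝ) : ℂ) = p ^ 2 + 3 * p * q + 3 * q ^ 2 := by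
    exact_mod_cast hN'
  have hpos : (0 : ℝ) < p ^ 2 + 3 * p * q + 3 * q ^ 2 := by rw [← hN']; positivity
  have hpC : (p : ℂ) ^ 2 + 3 * p * q + 3 * q ^ 2 ≠ 0 := by exact_mod_cast hpos.ne'
  have hpt : circlePt (p / q) = ((p + q + q * eisOmega) ^ 2) / (p ^ 2 + 3 * p * q + 3 * q ^ 2) := by
    rw [circlePt, ← hNC', div_eq_div_iff hNC (mul_ne_zero (pow_ne_zero 2 hqC) hNC)]
    push_cast
    field_simp
  split_ifs with h3
  · obtain ⟨t, rfl⟩ := h3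
    have hcop : IsCoprime (3 * t ^ 2) ((q : ℤ) ^ 2) := by
      refine IsCoprime.pow_right ?_
      exact (IsCoprime.of_mul_left_left hpq).mul_left (IsCoprime.of_mul_left_right hpq).pow_left
    obtain ⟨u, w, huw⟩ := hcop
    rw [hN']
    have hpos' : 0 < 3 * t ^ 2 + 3 * t * q + (q : ℤ) ^ 2 := by
      push_cast at hpos
      have : (0 : ℝ) < 3 * t ^ 2 + 3 * t * q + (q : ℝ) ^ 2 := by nlinarith
      exact_mod_cast this
    have hC : (3 : ℂ) * t ^ 2 + 3 * t * q + (q : ℂ) ^ 2 ≠ 0 := by exact_mod_cast hpos'.ne'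
    -- The combinations -a - 2b + 2c = 3t² and -2a - b + 2c = q² turn the Bézout relation for 3t²
    -- and q² into one for a, b, c. The other case is the same with p² and 3q².
    have := eisHeight_eq_of_eq (y := circlePt ((3 * t : ℤ) / q)) (a := 3 * t ^ 2 + 2 * t * q)
      (b := 2 * t * q + q ^ 2) (c := 3 * t ^ 2 + 3 * t * q + q ^ 2) (u := u - 2 * u - 2 * w)
      (w := -2 * u - w) (z := 2 * u + 2 * w) hpos' (by linear_combination huw) ?_
    · have h2 : (eisHeight (circlePt ((3 * t : ℤ) / q)) : ℝ) =
          ((3 * t ^ 2 + 3 * t * q + q ^ 2 : ℤ) : ℝ) := by exact_mod_cast this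
      rw [h2]
      push_cast
      ring
    · rw [hpt]
      push_cast at hpC ⊢
      rw [div_eq_div_iff hpC hC]
      linear_combination ((q : ℂ) ^ 2 * (3 * t ^ 2 + 3 * t * q + (q : ℂ) ^ 2)) * eisOmega_sq
  · have hcop : IsCoprime (p ^ 2) (3 * (q : ℤ) ^ 2) := by
      refine IsCoprime.pow_left (IsCoprime.mul_right ?_ hpq.pow_right)
      exact ((Int.prime_three.coprime_iff_not_dvd).mpr h3).symm
    obtain ⟨u, w, huw⟩ := hcop
    rw [hN']
    have hpos' : 0 < p ^ 2 + 3 * p * q + 3 * (q : ℤ) ^ 2 := by exact_mod_cast hpos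
    have := eisHeight_eq_of_eq (y := circlePt (p / q)) (a := p ^ 2 + 2 * p * q)
      (b := 2 * p * q + 3 * q ^ 2) (c := p ^ 2 + 3 * p * q + 3 * q ^ 2) (u := u - 2 * u - 2 * w)
      (w := -2 * u - w) (z := 2 * u + 2 * w) hpos' (by linear_combination huw) ?_
    · have h2 : (eisHeight (circlePt (p / q)) : ℝ) =
          ((p ^ 2 + 3 * p * q + 3 * q ^ 2 : ℤ) : ℝ) := by exact_mod_cast this
      rw [h2]
      push_cast
      ring
    · rw [hpt]
      push_cast
      congr 1
      linear_combination (q : ℂ) ^ 2 * eisOmega_sq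

theorem abs_mul_sub_eq (x : ℝ) (p : ℤ) {q : ℕ} (hq : 1 ≤ q) :
    |(q : ℝ) * x - p| = q * |x - p / q| := by
  have hq0 : (0 : ℝ) < q := by exact_mod_cast hq
  have h : (q : ℝ) * x - p = q * (x - p / q) := by field_simp
  rw [h, abs_mul, abs_of_pos hq0]

theorem dist_mul_eisHeight (x : ℝ) {p : ℤ} {q : ℕ} (hq : 1 ≤ q) (hpq : IsCoprime p q) :
    dist (circlePt x) (circlePt (p / q)) * eisHeight (circlePt (p / q)) =
      cuspDist x p q * (√(eisNorm (p / q)) / √(eisNorm x)) := by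
  have hs : √3 ^ 2 = 3 := Real.sq_sqrt (by norm_num)
  have hs0 : 0 < √3 := by positivity
  have hq0 : (0 : ℝ) < q := by exact_mod_cast hq
  have hx : 0 < √(eisNorm x) := Real.sqrt_pos.mpr (eisNorm_pos x)
  have hy : 0 < √(eisNorm (p / q)) := Real.sqrt_pos.mpr (eisNorm_pos _)
  have hy2 : eisNorm (p / q) = √(eisNorm (p / q)) ^ 2 := (Real.sq_sqrt (eisNorm_pos _).le).symm
  have e := abs_mul_sub_eq x p hq
  rw [dist_circlePt, eisHeight_circlePt hq hpq, cuspDist]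
  generalize √(eisNorm (p / q)) = B at hy hy2 ⊢
  generalize √(eisNorm x) = A at hx ⊢
  rw [hy2]
  split_ifs
  · rw [e]
    generalize |x - p / q| = D
    field_simp
    linear_combination D * hs
  · rw [e]
    field_simp

/-! ### The approximation constant in terms of fractions and of widths -/

/-- A lower bound for the approximation constant bounds the distances to all fractions. -/
theorem exists_lt_cuspDist_of_lt_eisDelta {x c c' : ℝ} (hc' : 0 < c') (hcc : c' < c)
    (h : ENNReal.ofReal c < eisDelta (circlePt x)) :
    ∃ Q : ℕ, ∀ (p : ℤ) (q : ℕ), IsCoprime p q → Q ≤ q → c' < cuspDist x p q := by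
  have h1 := eventually_lt_of_lt_liminf h
  rw [eventually_inf_principal, eventually_comap] at h1
  obtain ⟨H, hH⟩ := eventually_atTop.mp h1
  have hNx : 0 < √(eisNorm x) := Real.sqrt_pos.mpr (eisNorm_pos x)
  have hcont : ContinuousAt (fun u => √(eisNorm u) / √(eisNorm x)) x :=
    ((Real.continuous_sqrt.comp continuous_eisNorm).div_const _).continuousAt
  have hlt : (fun u => √(eisNorm u) / √(eisNorm x)) x < c / c' := by
    simp only
    rw [div_self hNx.ne', one_lt_div hc']
    exact hcc
  obtain ⟨ε, hε, hball⟩ := Metric.eventually_nhds_iff.mp (hcont.eventually_lt_const hlt)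
  -- The second bound brings p/q within ε of x; the third makes the height at least H, as the height
  -- is at least q²/4 by N ≥ 3/4.
  obtain ⟨Q, hQ⟩ := exists_nat_gt (max 1 (max (√3 * c' / ε) (4 * H)))
  obtain ⟨hQ1, hQ2⟩ := max_lt_iff.mp hQ
  obtain ⟨hQ2, hQ3⟩ := max_lt_iff.mp hQ2
  refine ⟨Q, fun p q hpq hq => ?_⟩
  by_contra hcon
  push Not at hcon
  have hqQ : (Q : ℝ) ≤ q := by exact_mod_cast hq
  have hq1 : (1 : ℝ) < q := by linarith
  have hq0 : 1 ≤ q := by exact_mod_cast hq1.le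
  have hqq : (q : ℝ) ≤ q ^ 2 := by nlinarith
  have hs0 : 0 < √3 := by positivity
  have hs1 : 1 < √3 := Real.lt_sqrt_of_sq_lt (by norm_num)
  have e := abs_mul_sub_eq x p hq0
  have hA : (q : ℝ) ^ 2 * |x - p / q| / √3 ≤ cuspDist x p q := by
    rw [cuspDist, e]
    have h0 : 0 ≤ (q : ℝ) ^ 2 * |x - p / q| := by positivity
    split_ifs
    · exact le_of_eq (by ring)
    · rw [div_le_iff₀ hs0]
      have : √3 * ((q : ℝ) * (q * |x - p / q|)) * √3 =
        (√3 * √3) * ((q : ℝ) ^ 2 * |x - p / q|) := by ring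
      rw [this, Real.mul_self_sqrt (by norm_num)]
      linarith
  have hclose : |(p : ℝ) / q - x| < ε := by
    rw [abs_sub_comm]
    rw [div_lt_iff₀ hε] at hQ2
    have h2 := hA.trans hcon
    rw [div_le_iff₀ hs0] at h2
    by_contra h3
    push Not at h3
    nlinarith
  have hr := hball (y := (p : ℝ) / q) hclose
  have hht : H ≤ eisHeight (circlePt (p / q)) := by
    rw [eisHeight_circlePt hq0 hpq]
    have := three_quarters_le_eisNorm (p / q)
    split_ifs <;> nlinarith
  have hmem : circlePt ((p : ℝ) / q) ∈ eisPoints := by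
    have := circlePt_rat_mem ((p : ℚ) / q)
    push_cast at this
    exact this
  have h2 := hH _ hht _ rfl hmem
  rw [ENNReal.ofReal_lt_ofReal_iff_of_nonneg (by linarith), div_inv_eq_mul,
    dist_mul_eisHeight x hq0 hpq] at h2
  have h4 : 0 < √(eisNorm (p / q)) / √(eisNorm x) :=
    div_pos (Real.sqrt_pos.mpr (eisNorm_pos _)) hNx
  rw [lt_div_iff₀ hc'] at hr
  nlinarith

theorem ofReal_le_eisDelta {x c c' : ℝ} (hc' : 0 < c') (hcc : c' < c) {Q : ℕ}
    (hQ : ∀ (p : ℤ) (q : ℕ), IsCoprime p q → Q ≤ q → c < cuspDist x p q) :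
    ENNReal.ofReal c' ≤ eisDelta (circlePt x) := by
  have hNx : 0 < √(eisNorm x) := Real.sqrt_pos.mpr (eisNorm_pos x)
  have hcoord := continuousAt_circleCoord x
  have hcont : ContinuousAt (fun y => √(eisNorm (circleCoord y)) / √(eisNorm x)) (circlePt x) := by
    refine ContinuousAt.div_const ?_ _
    exact (Real.continuous_sqrt.comp continuous_eisNorm).continuousAt.comp hcoord
  have hcont' : ContinuousAt (fun y => eisNorm (circleCoord y)) (circlePt x) :=
    continuous_eisNorm.continuousAt.comp hcoord
  have hgt : c' / c < (fun y => √(eisNorm (circleCoord y)) / √(eisNorm x)) (circlePt x) := by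
    simp only
    rw [circleCoord_circlePt, div_self hNx.ne', div_lt_one (by linarith)]
    exact hcc
  have hlt : (fun y => eisNorm (circleCoord y)) (circlePt x) < eisNorm x + 1 := by
    simp only
    rw [circleCoord_circlePt]
    linarith
  obtain ⟨ε, hε, hball⟩ := Metric.eventually_nhds_iff.mp
    ((hcont.eventually_const_lt hgt).and (hcont'.eventually_lt_const hlt))
  refine le_liminf_of_le (by isBoundedDefault) ?_
  rw [eventually_inf_principal, eventually_comap]
  -- The bounds on H exclude the point 1, which is not parametrized and has height 1, bring y within
  -- ε of the point, and force a denominator of at least Q.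
  filter_upwards [eventually_gt_atTop (max 1 (max (c' / ε) (Q ^ 2 * (eisNorm x + 1))))]
    with H hH y hy hyZ
  subst hy
  obtain ⟨hH1, hH2⟩ := max_lt_iff.mp hH
  obtain ⟨hH2, hH3⟩ := max_lt_iff.mp hH2
  have hy1 : y ≠ 1 := by rintro rfl; simp [eisHeight_one] at hH1
  apply ENNReal.ofReal_le_ofReal
  rw [div_inv_eq_mul]
  by_contra hcon
  push Not at hcon
  have hd : dist y (circlePt x) < ε := by
    rw [dist_comm]
    rw [div_lt_iff₀ hε] at hH2
    by_contra h3
    push Not at h3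
    nlinarith
  obtain ⟨b1, b2⟩ := hball hd
  obtain ⟨u, hu⟩ := exists_rat_circleCoord hyZ.2
  have hyu : y = circlePt u := by rw [← hu, circlePt_circleCoord hyZ.1 hy1]
  rw [hu] at b1 b2
  have hpq : IsCoprime u.num (u.den : ℤ) := by
    rw [Int.isCoprime_iff_gcd_eq_one]
    exact u.reduced
  have hden : 1 ≤ u.den := u.den_pos
  have hur : (u : ℝ) = (u.num : ℝ) / (u.den : ℕ) := Rat.cast_def u
  rw [hyu, hur, dist_mul_eisHeight x hden hpq] at hcon
  rw [hyu, hur, eisHeight_circlePt hden hpq] at hH3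
  rw [hur] at b1 b2
  have hqQ : Q ≤ u.den := by
    by_contra hlt
    push Not at hlt
    have h1 : (u.den : ℝ) ≤ Q := by exact_mod_cast hlt.le
    have h2 : (u.den : ℝ) ^ 2 ≤ (Q : ℝ) ^ 2 := by gcongr
    have h3 := eisNorm_pos ((u.num : ℝ) / u.den)
    have h4 : (u.den : ℝ) ^ 2 * eisNorm (u.num / u.den) ≤ (Q : ℝ) ^ 2 * (eisNorm x + 1) := by
      gcongr
    have h5 : 0 ≤ (u.den : ℝ) ^ 2 * eisNorm (u.num / u.den) := by positivity
    split_ifs at hH3 <;> linarith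
  have h6 := hQ _ _ hpq hqQ
  rw [div_lt_iff₀ (by linarith)] at b1
  have h7 : 0 < √(eisNorm (u.num / u.den)) / √(eisNorm x) :=
    div_pos (Real.sqrt_pos.mpr (eisNorm_pos _)) hNx
  nlinarith

namespace IsSideChain

variable {d : ℕ → HexSide} {ξ : ℕ → ℝ} {v : ℕ → ℕ × ℕ}

/-- For rational ξ 0 = a/b, the product of the integer qa - pb with qξ + s is ±b. The integer is
nonzero, and s is eventually larger than b. -/
theorem irrational (h : IsSideChain d ξ v) : Irrational (ξ 0) := by
  rintro ⟨u, hu⟩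
  obtain ⟨n, hn⟩ := (h.tendsto_snd.eventually_gt_atTop u.den).exists
  obtain ⟨hξ, p, r, -, hdet, hx⟩ := h.crossesSide 0 n
  rw [← hu] at hx
  have hden : (0 : ℝ) < u.den := by exact_mod_cast u.den_pos
  have e : (u : ℝ) * u.den = u.num := by
    rw [Rat.cast_def]; field_simp
  have hkey : (((v n).1 * u.num - p * u.den : ℤ) : ℝ) * ((v n).1 * ξ n + (v n).2) =
      -((p * (v n).2 - (v n).1 * r : ℤ) : ℝ) * u.den := by
    push_cast
    linear_combination (v n).1 * u.den * hx - (v n).1 * ((v n).1 * ξ n + (v n).2) * e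
  have hdet' : |((p * (v n).2 - (v n).1 * r : ℤ) : ℝ)| = 1 := by
    rcases hdet with e | e <;> rw [e] <;> simp
  have hpos : 0 ≤ (v n).1 * ξ n := by positivity
  have habs := congrArg abs hkey
  have hn' : (u.den : ℝ) < (v n).2 := by exact_mod_cast hn
  rw [abs_mul, abs_mul, abs_neg, hdet', one_mul, abs_of_pos hden,
    abs_of_pos (show 0 < (v n).1 * ξ n + ((v n).2 : ℝ) by linarith)] at habs
  have hne : (v n).1 * u.num - p * u.den ≠ 0 := by
    intro h0
    rw [h0, Int.cast_zero, abs_zero, zero_mul] at habs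
    exact hden.ne habs
  have h1 : (1 : ℝ) ≤ |(((v n).1 * u.num - p * u.den : ℤ) : ℝ)| := by
    exact_mod_cast Int.one_le_abs hne
  nlinarith

/-- The hypothesis 3 < Λ places constants just below √3/Λ under 1/√3, the range in which every close
fraction is an endpoint of a crossed side. -/
theorem eisDelta_eq (h : IsSideChain d ξ v) (k : ℤ) {Λ : ℝ} (hΛ : 3 < Λ)
    (hl : HasWidthLimsup (fun n => ξ (n + 1)) (fun n => ((v (n + 1)).2 : ℝ) / (v (n + 1)).1) Λ) :
    eisDelta (circlePt (ξ 0 + 3 * k)) = ENNReal.ofReal (√3 / Λ) := by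
  have hs0 : 0 < √3 := by positivity
  have hs : √3 ^ 2 = 3 := Real.sq_sqrt (by norm_num)
  have hΛ0 : 0 < Λ := by linarith
  apply le_antisymm
  · by_contra hcon
    push Not at hcon
    obtain ⟨a, ha1, ha2⟩ := ENNReal.lt_iff_exists_real_btwn.mp hcon
    obtain ⟨ha1, ha3⟩ := ha2
    have h1 : √3 / Λ < a := by
      rwa [ENNReal.ofReal_lt_ofReal_iff_of_nonneg (by positivity)] at ha1
    obtain ⟨c, hc1, hc2⟩ := exists_between h1
    have hc0 : 0 < c := lt_trans (by positivity) hc1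
    obtain ⟨Q, hQ⟩ := exists_lt_cuspDist_of_lt_eisDelta hc0 hc2 ha3
    have h2 := h.eventually_sideWidth_lt hc0 hQ
    have h3 : √3 / c < Λ := by
      rw [div_lt_iff₀ hΛ0] at hc1
      rw [div_lt_iff₀ hc0]
      linarith
    obtain ⟨n, hn1, hn2⟩ := ((hl.2 (Λ - √3 / c) (by linarith)).and_eventually h2).exists
    linarith
  · refine le_of_forall_lt fun b hb => ?_
    obtain ⟨a, ha0, ha1, ha2⟩ := ENNReal.lt_iff_exists_real_btwn.mp hb
    have h1 : a < √3 / Λ := (ENNReal.ofReal_lt_ofReal_iff (by positivity)).mp ha2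
    rcases ha0.eq_or_lt with rfl | ha0
    · simp at ha1
    obtain ⟨c, hc1, hc2⟩ := exists_between h1
    have hc0 : 0 < c := ha0.trans hc1
    have h3 : Λ < √3 / c := by
      rw [lt_div_iff₀ hΛ0] at hc2
      rw [lt_div_iff₀ hc0]
      linarith
    have h4 : c < 1 / √3 := by
      refine hc2.trans ?_
      rw [div_lt_div_iff₀ hΛ0 hs0]
      linarith
    obtain ⟨Q, hQ⟩ := h.exists_lt_cuspDist (k := k) h.irrational hc0 h4 (by
      filter_upwards [hl.1 (√3 / c - Λ) (by linarith)] with n hn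
      linarith)
    exact ha1.trans_le (ofReal_le_eisDelta ha0 hc1 hQ)

end IsSideChain

/-! ### The constants exceeding √3/4 -/

theorem three_lt_widthSeq (j : ℕ) : 3 < widthSeq j := by
  refine lt_of_lt_of_le ?_ (widthSeq_strictMono.monotone (Nat.zero_le j))
  simp only [widthSeq]
  have : 3 / 2 < √3 := Real.lt_sqrt_of_sq_lt (by norm_num)
  linarith

theorem exists_eisDelta_eq_of_lt {P : ℂ} (hP : P ∈ unitCircleC \ eisPoints)
    (h : ENNReal.ofReal (√3 / 4) < eisDelta P) :
    ∃ j, eisDelta P = ENNReal.ofReal (√3 / widthSeq j) := by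
  have hs0 : 0 < √3 := by positivity
  have hP1 : P ≠ 1 := by
    rintro rfl
    exact hP.2 ⟨hP.1, eisField.one_mem⟩
  obtain ⟨x, rfl⟩ : ∃ x, P = circlePt x := ⟨_, (circlePt_circleCoord hP.1 hP1).symm⟩
  have hirr : Irrational x := by
    by_contra hx
    exact hP.2 ((circlePt_mem_iff x).mpr hx)
  -- Translation by 3 preserves the tessellation, so x is moved into the base of the first hexagon.
  obtain ⟨k, y, hy0, hy3, rfl⟩ : ∃ (k : ℤ) (y : ℝ), 0 ≤ y ∧ y < 3 ∧ x = y + 3 * k := by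
    refine ⟨⌊x / 3⌋, x - 3 * ⌊x / 3⌋, ?_, ?_, by ring⟩
    · have := Int.floor_le (x / 3); linarith
    · have := Int.lt_floor_add_one (x / 3); linarith
  have hyirr : Irrational y := by
    rintro ⟨u, rfl⟩
    exact hirr ⟨u + 3 * k, by push_cast; ring⟩
  have hy0' : 0 < y := hy0.lt_of_ne fun h0 => hyirr ⟨0, by simp [← h0]⟩
  obtain ⟨d, ξ, v, hch, rfl⟩ := exists_isSideChain hy0' hy3 hyirr
  obtain ⟨a, ha0, ha1, ha2⟩ := ENNReal.lt_iff_exists_real_btwn.mp h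
  have h1 : √3 / 4 < a := by
    rwa [ENNReal.ofReal_lt_ofReal_iff_of_nonneg (by positivity)] at ha1
  obtain ⟨c, hc1, hc2⟩ := exists_between h1
  have hc0 : 0 < c := lt_trans (by positivity) hc1
  obtain ⟨Q, hQ⟩ := exists_lt_cuspDist_of_lt_eisDelta hc0 hc2 ha2
  have h2 := hch.eventually_sideWidth_lt hc0 hQ
  obtain ⟨j, hj⟩ := hch.isOrbit.exists_hasWidthLimsup (by
    filter_upwards [h2] with n hn
    refine hn.trans ?_
    rw [div_lt_iff₀ hc0]
    linarith)
  exact ⟨j, hch.eisDelta_eq k (three_lt_widthSeq j) hj⟩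

theorem exists_isSideChain_limsup (j : ℕ) : ∃ d ξ v, IsSideChain d ξ v ∧
    HasWidthLimsup (fun n => ξ (n + 1)) (fun n => ((v (n + 1)).2 : ℝ) / (v (n + 1)).1)
      (widthSeq j) := by
  match j with
  | 0 =>
    have hs : √3 ^ 2 = 3 := Real.sq_sqrt (by norm_num)
    have hs0 : 0 < √3 := by positivity
    obtain ⟨v, hv⟩ := exists_isSideChain_of_fwd (d := fun _ => s3) (ξ := fun _ => √3)
      (by nlinarith) (fun _ => hs0) (fun _ => by
        simp only [fwd]; rw [eq_div_iff (by positivity)]; linear_combination hs)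
    exact ⟨_, _, v, hv, hv.isOrbit.hasWidthLimsup_of_s3 (N := 0) fun _ _ => rfl⟩
  | 1 =>
    have hs : √13 ^ 2 = 13 := Real.sq_sqrt (by norm_num)
    have hs0 : 0 < √13 := by positivity
    obtain ⟨v, hv⟩ := exists_isSideChain_of_fwd (d := fun _ => s4) (ξ := fun _ => (1 + √13) / 2)
      (by nlinarith) (fun _ => by positivity) (fun _ => by
        simp only [fwd]; rw [eq_div_iff (by positivity)]; linear_combination hs / 4)
    exact ⟨_, _, v, hv, hv.isOrbit.hasWidthLimsup_of_s4 (N := 0) fun _ _ => rfl⟩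
  | j + 2 =>
    set m := j + 1 with hm
    have hX := one_lt_runFwd m
    have h3 : 1 ≤ s3.fwd (runFwd m) := by linarith [lt_fwd_s3 (show 0 < runFwd m by linarith)]
    have hfix := runFwd_fixed m
    set ξ : ℕ → ℝ := fun n => s4.fwd^[2 * m - n % (2 * m + 1)] (s3.fwd (runFwd m)) with hξ
    set d : ℕ → HexSide := fun n => if n % (2 * m + 1) < 2 * m then s4 else s3 with hd
    have h0 : ξ 0 < 3 := by
      obtain ⟨b, hb⟩ : ∃ b, 2 * m = b + 1 := ⟨2 * m - 1, by omega⟩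
      simp only [hξ, Nat.zero_mod, Nat.sub_zero]
      rw [hb, Function.iterate_succ_apply']
      have := one_le_iterate_fwd one_le_fwd_s4 h3 b
      exact fwd_s4_lt (by linarith)
    have hpos : ∀ n, 0 < ξ n := fun n => by
      have := one_le_iterate_fwd one_le_fwd_s4 h3 (2 * m - n % (2 * m + 1))
      simp only [hξ]
      linarith
    have hstep : ∀ n, ξ n = (d n).fwd (ξ (n + 1)) := by
      intro n
      simp only [hξ, hd]
      have hlt := Nat.mod_lt n (show 0 < 2 * m + 1 by omega)
      rcases Nat.lt_or_ge (n % (2 * m + 1)) (2 * m) with h1 | h1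
      · have e : (n + 1) % (2 * m + 1) = n % (2 * m + 1) + 1 := by
          rw [Nat.add_mod, Nat.mod_eq_of_lt (show 1 < 2 * m + 1 by omega),
            Nat.mod_eq_of_lt (by omega)]
        rw [if_pos h1, e, ← Function.iterate_succ_apply' s4.fwd]
        congr 1
        omega
      · have e0 : n % (2 * m + 1) = 2 * m := by omega
        have e : (n + 1) % (2 * m + 1) = 0 := by
          rw [Nat.add_mod, e0, Nat.mod_eq_of_lt (show 1 < 2 * m + 1 by omega), Nat.mod_self]
        rw [if_neg (by omega), e, e0, Nat.sub_self, Nat.sub_zero, hfix]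
        rfl
    obtain ⟨v, hv⟩ := exists_isSideChain_of_fwd h0 hpos hstep
    -- The orbit of a chain starts at its index 1, so the first complete period begins at 2m and not
    -- at 2m + 1.
    refine ⟨d, ξ, v, hv, hv.isOrbit.hasWidthLimsup_of_isRunPeriodic (m := m) (n₀ := 2 * m)
      (by omega) fun i => ?_⟩
    have e : ∀ a, a < 2 * m + 1 → (2 * m + i * (2 * m + 1) + a + 1) % (2 * m + 1) = a := by
      intro a ha
      rw [show 2 * m + i * (2 * m + 1) + a + 1 = a + (2 * m + 1) * (i + 1) by ring,
        Nat.add_mul_mod_self_left, Nat.mod_eq_of_lt ha]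
    refine ⟨fun a ha => ?_, ?_⟩
    · simp only [hd]
      rw [e a (by omega), if_pos ha]
    · simp only [hd]
      rw [e _ (by omega), if_neg (lt_irrefl _)]

theorem ofReal_mem_eisDeltaSet (j : ℕ) : ENNReal.ofReal (√3 / widthSeq j) ∈ eisDeltaSet := by
  obtain ⟨d, ξ, v, h, hl⟩ := exists_isSideChain_limsup j
  refine ⟨circlePt (ξ 0 + 3 * (0 : ℤ)), ⟨norm_circlePt _, ?_⟩,
    h.eisDelta_eq 0 (three_lt_widthSeq j) hl⟩
  rw [circlePt_mem_iff, not_not]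
  simpa using h.irrational

/-! ### Ordering the constants and the Lagrange spectrum -/

/-- The approximation constants exceeding `√3 / 4`, in decreasing order. -/
noncomputable def deltaSeq (k : ℕ) : ℝ := √3 / widthSeq (k - 1)

theorem deltaSeq_pos (k : ℕ) : 0 < deltaSeq k :=
  div_pos (by positivity) (widthSeq_pos _)

theorem one_div_deltaSeq (k : ℕ) : 1 / deltaSeq k = widthSeq (k - 1) / √3 := one_div_div _ _

theorem deltaSeq_lt {i k : ℕ} (hi : 1 ≤ i) (h : i < k) : deltaSeq k < deltaSeq i :=
  div_lt_div_of_pos_left (by positivity) (widthSeq_pos _) (widthSeq_strictMono (by omega))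

theorem lt_deltaSeq (k : ℕ) : √3 / 4 < deltaSeq k :=
  div_lt_div_of_pos_left (by positivity) (widthSeq_pos _) (widthSeq_lt_four _)

theorem deltaSeq_lt_iff {i k : ℕ} (hi : 1 ≤ i) (hk : 1 ≤ k) : deltaSeq k < deltaSeq i ↔ i < k := by
  refine ⟨fun h => ?_, deltaSeq_lt hi⟩
  by_contra hik
  rcases (not_lt.mp hik).eq_or_lt with rfl | h2
  · exact lt_irrefl _ h
  · exact lt_asymm h (deltaSeq_lt hk h2)

theorem deltaSeq_injOn : Set.InjOn deltaSeq {k | 1 ≤ k} := by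
  intro i hi k hk h
  rcases lt_trichotomy i k with h1 | h1 | h1
  · exact absurd h (deltaSeq_lt hi h1).ne'
  · exact h1
  · exact absurd h (deltaSeq_lt hk h1).ne

theorem ofReal_deltaSeq_mem (k : ℕ) : ENNReal.ofReal (deltaSeq k) ∈ eisDeltaSet :=
  ofReal_mem_eisDeltaSet _

theorem exists_deltaSeq_eq {s : ℝ≥0∞} (hs : s ∈ eisDeltaSet) (h : ENNReal.ofReal (√3 / 4) < s) :
    ∃ k, 1 ≤ k ∧ s = ENNReal.ofReal (deltaSeq k) := by
  obtain ⟨P, hP, rfl⟩ := hs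
  obtain ⟨j, hj⟩ := exists_eisDelta_eq_of_lt hP h
  exact ⟨j + 1, by omega, by rw [hj, deltaSeq, Nat.add_sub_cancel]⟩

theorem setOf_deltaSeq_lt {k : ℕ} (hk : 1 ≤ k) :
    {y ∈ eisDeltaSet | ENNReal.ofReal (deltaSeq k) < y} =
      (fun i => ENNReal.ofReal (deltaSeq i)) '' Set.Ico 1 k := by
  ext y
  constructor
  · rintro ⟨hy, hlt⟩
    obtain ⟨i, hi, rfl⟩ := exists_deltaSeq_eq hy
      ((ENNReal.ofReal_le_ofReal (lt_deltaSeq k).le).trans_lt hlt)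
    rw [ENNReal.ofReal_lt_ofReal_iff (deltaSeq_pos i), deltaSeq_lt_iff hi hk] at hlt
    exact ⟨i, ⟨hi, hlt⟩, rfl⟩
  · rintro ⟨i, ⟨hi, hik⟩, rfl⟩
    exact ⟨ofReal_deltaSeq_mem i, (ENNReal.ofReal_lt_ofReal_iff (deltaSeq_pos i)).mpr
      (deltaSeq_lt hi hik)⟩

theorem encard_Ico_add_one {k : ℕ} (hk : 1 ≤ k) : (Set.Ico 1 k).encard + 1 = k := by
  rw [← Finset.coe_Ico, Set.encard_coe_eq_coe_finsetCard, Nat.card_Ico]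
  exact_mod_cast Nat.sub_add_cancel hk

theorem isKthLargest_deltaSeq {k : ℕ} (hk : 1 ≤ k) :
    IsKthLargest eisDeltaSet k (ENNReal.ofReal (deltaSeq k)) := by
  refine ⟨ofReal_deltaSeq_mem k, ?_⟩
  rw [setOf_deltaSeq_lt hk, Set.InjOn.encard_image, encard_Ico_add_one hk]
  intro i hi j hj h
  refine deltaSeq_injOn hi.1 hj.1 ?_
  exact (ENNReal.ofReal_eq_ofReal_iff (deltaSeq_pos i).le (deltaSeq_pos j).le).mp h

theorem one_div_deltaSeq_mem (k : ℕ) : 1 / deltaSeq k ∈ eisLagrangeSpectrum := by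
  obtain ⟨P, hP, h⟩ := ofReal_deltaSeq_mem k
  refine ⟨P, hP, ?_, ?_⟩
  · rw [h]
    exact ENNReal.ofReal_pos.mpr (deltaSeq_pos k)
  · rw [h, ENNReal.toReal_inv, ENNReal.toReal_ofReal (deltaSeq_pos k).le, one_div]

/-- Below `4 / √3` the Lagrange spectrum consists of the reciprocals of `deltaSeq`. -/
theorem exists_eq_one_div_deltaSeq {L : ℝ} (hL : L ∈ eisLagrangeSpectrum) (h : L < 4 / √3) :
    ∃ k, 1 ≤ k ∧ L = 1 / deltaSeq k := by
  obtain ⟨P, hP, hpos, rfl⟩ := hL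
  have hs0 : 0 < √3 := by positivity
  obtain ⟨k, hk, e⟩ := exists_deltaSeq_eq ⟨P, hP, rfl⟩ (by
    -- If δ ≤ √3/4 then δ is finite and its reciprocal is at least 4/√3. Finiteness matters because
    -- δ = ⊤ would give the junk value L = 0.
    by_contra hle
    push Not at hle
    have hfin : eisDelta P ≠ ⊤ := (hle.trans_lt ENNReal.ofReal_lt_top).ne
    have h1 : 0 < (eisDelta P).toReal := ENNReal.toReal_pos hpos.ne' hfin
    have h2 : (eisDelta P).toReal ≤ √3 / 4 := ENNReal.toReal_le_of_le_ofReal (by positivity) hle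
    rw [ENNReal.toReal_inv, inv_lt_comm₀ h1 (by positivity), inv_div] at h
    linarith)
  refine ⟨k, hk, ?_⟩
  rw [e, ENNReal.toReal_inv, ENNReal.toReal_ofReal (deltaSeq_pos k).le, one_div]

theorem one_div_deltaSeq_lt (k : ℕ) : 1 / deltaSeq k < 4 / √3 := by
  rw [one_div_deltaSeq]
  exact div_lt_div_of_pos_right (widthSeq_lt_four _) (by positivity)

theorem one_div_deltaSeq_lt_iff {i k : ℕ} (hi : 1 ≤ i) (hk : 1 ≤ k) :
    1 / deltaSeq i < 1 / deltaSeq k ↔ i < k := by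
  rw [one_div_lt_one_div (deltaSeq_pos i) (deltaSeq_pos k), deltaSeq_lt_iff hi hk]

theorem setOf_lt_one_div_deltaSeq {k : ℕ} (hk : 1 ≤ k) :
    {y ∈ eisLagrangeSpectrum | y < 1 / deltaSeq k} = (fun i => 1 / deltaSeq i) '' Set.Ico 1 k := by
  ext y
  constructor
  · rintro ⟨hy, hlt⟩
    obtain ⟨i, hi, rfl⟩ := exists_eq_one_div_deltaSeq hy (hlt.trans (one_div_deltaSeq_lt k))
    exact ⟨i, ⟨hi, (one_div_deltaSeq_lt_iff hi hk).mp hlt⟩, rfl⟩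
  · rintro ⟨i, ⟨hi, hik⟩, rfl⟩
    exact ⟨one_div_deltaSeq_mem i, (one_div_deltaSeq_lt_iff hi hk).mpr hik⟩

theorem isKthSmallest_deltaSeq {k : ℕ} (hk : 1 ≤ k) :
    IsKthSmallest eisLagrangeSpectrum k (1 / deltaSeq k) := by
  refine ⟨one_div_deltaSeq_mem k, ?_⟩
  rw [setOf_lt_one_div_deltaSeq hk, Set.InjOn.encard_image, encard_Ico_add_one hk]
  intro i hi j hj h
  refine deltaSeq_injOn hi.1 hj.1 ?_
  simpa using h

theorem deltaSeq_one : deltaSeq 1 = 1 / 2 := by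
  have hs0 : √3 ≠ 0 := by positivity
  simp only [deltaSeq, Nat.sub_self, widthSeq]
  field_simp

theorem deltaSeq_two : deltaSeq 2 = √(3 / 13) := by
  simp only [deltaSeq, Nat.add_one_sub_one, widthSeq]
  rw [Real.sqrt_div (by norm_num)]

theorem deltaSeq_of_three_le {k : ℕ} (hk : 3 ≤ k) : deltaSeq k = (√3 / 2) /
    √(4 - 13 / (((3 + √13) / 2) ^ (2 * k - 3) - ((3 - √13) / 2) ^ (2 * k - 3)) ^ 2) := by
  obtain ⟨j, rfl⟩ : ∃ j, k = j + 3 := ⟨k - 3, by omega⟩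
  rw [show 2 * (j + 3) - 3 = 2 * j + 3 by omega, ← bronze_eq, mul_pow,
    Real.sq_sqrt (by norm_num), div_mul_cancel_right₀ (by norm_num)]
  simp only [deltaSeq, show j + 3 - 1 = j + 2 by omega, widthSeq]
  rw [one_div, div_div]

theorem deltaSeq_tendsto : Tendsto deltaSeq atTop (𝓝 (√3 / 4)) :=
  tendsto_const_nhds.div (widthSeq_tendsto.comp (tendsto_sub_atTop_nat 1)) (by norm_num)

theorem isLeast_eisLagrangeSpectrum : IsLeast eisLagrangeSpectrum 2 := by
  have h2 : 1 / deltaSeq 1 = 2 := by rw [deltaSeq_one]; norm_num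
  refine ⟨h2 ▸ one_div_deltaSeq_mem 1, fun y hy => ?_⟩
  by_contra hlt
  push Not at hlt
  have hmem : y ∈ {y ∈ eisLagrangeSpectrum | y < 1 / deltaSeq 1} := ⟨hy, by rwa [h2]⟩
  rw [setOf_lt_one_div_deltaSeq le_rfl] at hmem
  simp at hmem

theorem isLeast_accPt_eisLagrangeSpectrum :
    IsLeast {x : ℝ | AccPt x (𝓟 eisLagrangeSpectrum)} (4 / √3) := by
  have hs0 : 0 < √3 := by positivity
  have hlim : Tendsto (fun k => 1 / deltaSeq k) atTop (𝓝 (4 / √3)) := by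
    have := deltaSeq_tendsto.inv₀ (by positivity)
    simpa [one_div, inv_div] using this
  constructor
  · rw [Set.mem_ofPred_eq, accPt_iff_frequently]
    refine hlim.frequently (Frequently.of_forall fun k => ?_)
    exact ⟨(one_div_deltaSeq_lt k).ne, one_div_deltaSeq_mem k⟩
  · intro x hx
    by_contra hlt
    push Not at hlt
    obtain ⟨k, hk⟩ := (hlim.eventually_const_lt hlt).and (eventually_ge_atTop 1) |>.exists
    obtain ⟨hxk, hk1⟩ := hk
    -- A point below 4/√3 lies below some 1/δ k, under which the spectrum has only finitely many
    -- elements and hence no accumulation point.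
    have hfin : {y ∈ eisLagrangeSpectrum | y < 1 / deltaSeq k}.Finite := by
      rw [setOf_lt_one_div_deltaSeq hk1]
      exact (Set.finite_Ico 1 k).image _
    rw [Set.mem_ofPred_eq, accPt_iff_frequently] at hx
    have hclosed : IsClosed ({y ∈ eisLagrangeSpectrum | y < 1 / deltaSeq k} \ {x}) :=
      (hfin.subset Set.sdiff_subset).isClosed
    have hmem : ({y ∈ eisLagrangeSpectrum | y < 1 / deltaSeq k} \ {x})ᶜ ∈ 𝓝 x :=
      hclosed.isOpen_compl.mem_nhds fun h => h.2 rfl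
    obtain ⟨y, ⟨hyx, hyL⟩, hy1, hy2⟩ :=
      (hx.and_eventually ((eventually_lt_nhds hxk).and hmem)).exists
    exact hy2 ⟨⟨hyL, hy1⟩, hyx⟩

theorem theorem1p3 :
    ∃ δ : ℕ → ℝ,
      (∀ k : ℕ, 1 ≤ k →
        0 < δ k ∧
        IsKthLargest eisDeltaSet k (ENNReal.ofReal (δ k)) ∧
        IsKthSmallest eisLagrangeSpectrum k (1 / δ k)) ∧
      δ 1 = 1 / 2 ∧
      δ 2 = √(3 / 13) ∧
      (∀ k : ℕ, 3 ≤ k →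
        δ k = (√3 / 2) /
          √(4 - 13 / (((3 + √13) / 2) ^ (2 * k - 3) - ((3 - √13) / 2) ^ (2 * k - 3)) ^ 2)) ∧
      Tendsto δ atTop (𝓝 (√3 / 4)) ∧
      IsLeast eisLagrangeSpectrum 2 ∧
      IsLeast {x : ℝ | AccPt x (𝓟 eisLagrangeSpectrum)} (4 / √3) :=
  ⟨deltaSeq,
    fun k hk => ⟨deltaSeq_pos k, isKthLargest_deltaSeq hk, isKthSmallest_deltaSeq hk⟩,
    deltaSeq_one, deltaSeq_two, fun _ hk => deltaSeq_of_three_le hk, deltaSeq_tendsto,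
    isLeast_eisLagrangeSpectrum, isLeast_accPt_eisLagrangeSpectrum⟩
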